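/- **Definitions.** Let $\Sigma$ be a finite alphabet. An operator grammar is a context-free grammar in which no right-hand side contains two adjacent nonterminals. For a nonterminal $A$ put $\mathcal L(A)=\{a\in\Sigma \mid A\Rightarrow^* Ba\alpha\}$ and $\mathcal R(A)=\{a\in\Sigma \mid A\Rightarrow^*\alpha aB\}$, where $B$ is a nonterminal or $\varepsilon$ and $\alpha$ is any string of terminals and nonterminals. The grammar's operator precedence matrix $OPM(G)$ stores in cell $(a,b)\in\Sigma\times\Sigma$ the set of those of the following relations that hold: $a\doteq b$ (some rule $A\to\alpha aBb\beta$ with $B$ a nonterminal or $\varepsilon$), $a\lessdot b$ (some rule $A\to\alpha aD\beta$ with $D$ a nonterminal and $b\in\mathcal L(D)$), $a\gtrdot b$ (some rule $A\to\alpha Db\beta$ with $D$ a nonterminal and $a\in\mathcal R(D)$). A matrix $M$ that assigns to each pair in $\Sigma\times\Sigma$ a set of precedence relations is conflict-free if every cell has at most one element, complete if no cell is empty, and $\doteq$-acyclic if there is no cycle $a_1\doteq a_2\doteq\dots\doteq a_k\doteq a_1$ with $k\ge 1$. Inclusion of matrices is cellwise. An operator precedence grammar (OPG) is an operator grammar with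 conflict-free matrix. For a matrix $M$, let $\mathcal F_M$ be the family of the languages $L(G)$ of the OPGs $G$ with $OPM(G)\subseteq M$. Add a delimiter $\#$ with $\#\lessdot a$, $a\gtrdot\#$ for all $a\in\Sigma$ and $\#\doteq\#$. A nonempty word $x\in\Sigma^*$ is a chain body between $a_0$ and $a_{n+1}$ (elements of $\Sigma\cup\{\#\}$) if $x=x_0a_1x_1a_2\cdots a_nx_n$ with $n\ge1$, $a_1,\dots,a_n\in\Sigma$, $a_0\lessdot a_1\doteq a_2\doteq\dots\doteq a_n\gtrdot a_{n+1}$, some relation holds between $a_0$ and $a_{n+1}$, and each $x_i$ is empty or a chain body between $a_i$ and $a_{i+1}$. A grammar $G$ with axiom $S$ and language $\Sigma^*$ *has the structure defined by $M$* if for all words $u,x,v$ over $\Sigma$ with $x\neq\varepsilon$: there is a nonterminal $A$ with $S\Rightarrow^* uAv$ and $A\Rightarrow^* x$ if and only if $x$ is a chain body between the letters adjacent to $x$ in $\#uxv\#$. **Theorem.** Let $M$ be a conflict-free operator precedence matrix over $\Sigma$. 1. $\mathcal F_M$ contains $\emptyset$ and is closed under union, intersection and difference. 2. If $M$ is $\doteq$-acyclic,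 then $\mathcal F_M$ is a Boolean algebra: it has a largest (top) language $T\in\mathcal F_M$, which contains every language of $\mathcal F_M$, it contains $\emptyset$, and it is closed under union, intersection and the complement $L\mapsto T\setminus L$. 3. If moreover $M$ is complete, then $T=\Sigma^*$ with the structure defined by $M$: every OPG $G$ with $OPM(G)\subseteq M$ and $L(G)=T$ satisfies $OPM(G)=M$ and has the structure defined by $M$. -/

import Mathlib

/-- The three operator precedence relations: `lt` is `⋖` (yields precedence), `eq` is `≐`
(equal in precedence), `gt` is `⋗` (takes precedence). -/
inductive PrecRel : Type
  | lt
  | eq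
  | gt

/-- An operator precedence matrix: each cell stores a set of precedence relations. -/
abbrev OPMatrix (α : Type*) : Type _ := α → α → Set PrecRel

namespace OPMatrix

variable {α : Type*}

/-- Every cell has at most one element. -/
def ConflictFree (M : OPMatrix α) : Prop := ∀ a b, (M a b).Subsingleton

/-- No cell is empty. -/
def Complete (M : OPMatrix α) : Prop := ∀ a b, (M a b).Nonempty

/-- Cellwise inclusion of matrices. -/
def Contained (M₁ M₂ : OPMatrix α) : Prop := ∀ a b, M₁ a b ⊆ M₂ a b

/-- The relation `≐` has no circularities: there is no cycle `a ≐ ⋯ ≐ a`. -/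
def EqAcyclic (M : OPMatrix α) : Prop :=
  ∀ a, ¬ Relation.TransGen (fun b c => PrecRel.eq ∈ M b c) a a

/-- The matrix extended to `Σ ∪ {#}`, with `none` as the delimiter `#`:
`# ⋖ a`, `a ⋗ #` for every letter `a`, and `# ≐ #`. -/
def withDelim (M : OPMatrix α) : OPMatrix (Option α)
  | none, none => {PrecRel.eq}
  | none, some _ => {PrecRel.lt}
  | some _, none => {PrecRel.gt}
  | some a, some b => M a b

mutual

/-- `Chain M a₀ x b`: the word `a₀ x b` is a (simple or composed) chain with body `x`, that is,
`x = x₀ a₁ x₁ a₂ ⋯ aₙ xₙ` with `n ≥ 1`, `a₀ ⋖ a₁ ≐ a₂ ≐ ⋯ ≐ aₙ ⋗ b`, the cell `(a₀, b)` is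
non-empty, and each `xᵢ` is empty or the body of a chain between `aᵢ` and `aᵢ₊₁`
(`aₙ₊₁ = b`). -/
inductive Chain (M : OPMatrix α) : Option α → List α → Option α → Prop
  | intro {a₀ b : Option α} {a₁ : α} {x₀ y : List α} :
      (M.withDelim a₀ b).Nonempty → PrecRel.lt ∈ M.withDelim a₀ (some a₁) →
      ChainGap M a₀ x₀ (some a₁) → ChainTail M a₁ y b → Chain M a₀ (x₀ ++ a₁ :: y) b

/-- `ChainTail M aᵢ y b`: `y = xᵢ aᵢ₊₁ xᵢ₊₁ ⋯ aₙ xₙ` is the part of a chain body that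
follows `aᵢ`, the chain ending in `b`. -/
inductive ChainTail (M : OPMatrix α) : α → List α → Option α → Prop
  | last {a : α} {x : List α} {b : Option α} :
      PrecRel.gt ∈ M.withDelim (some a) b → ChainGap M (some a) x b → ChainTail M a x b
  | step {a c : α} {x y : List α} {b : Option α} :
      PrecRel.eq ∈ M a c → ChainGap M (some a) x (some c) → ChainTail M c y b →
      ChainTail M a (x ++ c :: y) b

/-- `ChainGap M a x b`: `x` is empty or the body of a chain between `a` and `b`. -/
inductive ChainGap (M : OPMatrix α) : Option α → List α → Option α → Prop
  | nil {a b : Option α} : ChainGap M a [] b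
  | chain {a b : Option α} {x : List α} : Chain M a x b → ChainGap M a x b

end

end OPMatrix

namespace ContextFreeGrammar

variable {α : Type*}

/-- A string in `V_N ∪ {ε}`: empty or a single nonterminal. -/
def IsOptNonterminal {N : Type*} (β : List (Symbol α N)) : Prop :=
  β = [] ∨ ∃ B : N, β = [Symbol.nonterminal B]

/-- An operator grammar: no right-hand side has two adjacent nonterminals. -/
def IsOperator (g : ContextFreeGrammar α) : Prop :=
  ∀ r ∈ g.rules, ∀ (β γ : List (Symbol α g.NT)) (B C : g.NT),
    r.output ≠ β ++ [Symbol.nonterminal B, Symbol.nonterminal C] ++ γ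

/-- The left terminal set `{a | A ⇒* B a γ, B ∈ V_N ∪ {ε}}`. -/
def leftTerminals (g : ContextFreeGrammar α) (A : g.NT) : Set α :=
  {a | ∃ β γ : List (Symbol α g.NT), IsOptNonterminal β ∧
    g.Derives [Symbol.nonterminal A] (β ++ [Symbol.terminal a] ++ γ)}

/-- The right terminal set `{a | A ⇒* γ a B, B ∈ V_N ∪ {ε}}`. -/
def rightTerminals (g : ContextFreeGrammar α) (A : g.NT) : Set α :=
  {a | ∃ γ β : List (Symbol α g.NT), IsOptNonterminal β ∧
    g.Derives [Symbol.nonterminal A] (γ ++ [Symbol.terminal a] ++ β)}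

/-- `a ≐ b`: some rule has the form `A → γ a B b δ` with `B ∈ V_N ∪ {ε}`. -/
def EqPrec (g : ContextFreeGrammar α) (a b : α) : Prop :=
  ∃ r ∈ g.rules, ∃ γ β δ : List (Symbol α g.NT), IsOptNonterminal β ∧
    r.output = γ ++ [Symbol.terminal a] ++ β ++ [Symbol.terminal b] ++ δ

/-- `a ⋗ b`: some rule has the form `A → γ D b δ` with `a` in the right terminal set of `D`. -/
def TakesPrec (g : ContextFreeGrammar α) (a b : α) : Prop :=
  ∃ r ∈ g.rules, ∃ (γ δ : List (Symbol α g.NT)) (D : g.NT),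
    r.output = γ ++ [Symbol.nonterminal D, Symbol.terminal b] ++ δ ∧ a ∈ g.rightTerminals D

/-- `a ⋖ b`: some rule has the form `A → γ a D δ` with `b` in the left terminal set of `D`. -/
def YieldsPrec (g : ContextFreeGrammar α) (a b : α) : Prop :=
  ∃ r ∈ g.rules, ∃ (γ δ : List (Symbol α g.NT)) (D : g.NT),
    r.output = γ ++ [Symbol.terminal a, Symbol.nonterminal D] ++ δ ∧ b ∈ g.leftTerminals D

/-- The operator precedence matrix of a grammar. -/
def opm (g : ContextFreeGrammar α) : OPMatrix α := fun a b =>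
  {ρ | match ρ with
    | PrecRel.lt => g.YieldsPrec a b
    | PrecRel.eq => g.EqPrec a b
    | PrecRel.gt => g.TakesPrec a b}

/-- An operator precedence grammar: an operator grammar with a conflict-free matrix. -/
def IsOPG (g : ContextFreeGrammar α) : Prop :=
  g.IsOperator ∧ g.opm.ConflictFree

/-- In some syntax tree of the sentence `u x v`, the displayed occurrence of `x` is the
frontier of a subtree: `S ⇒* u A v` and `A ⇒* x` for some nonterminal `A`. -/
def IsConstituent (g : ContextFreeGrammar α) (u x v : List α) : Prop :=
  ∃ A : g.NT,
    g.Derives [Symbol.nonterminal g.initial]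
      (u.map Symbol.terminal ++ [Symbol.nonterminal A] ++ v.map Symbol.terminal) ∧
    g.Derives [Symbol.nonterminal A] (x.map Symbol.terminal)

/-- The structure that `g` gives to the words of `Σ*` is the one defined by `M`: for every word
`u x v` with `x` non-empty, this occurrence of `x` is the frontier of a subtree of a syntax tree
of `u x v` iff it is the body of a chain whose delimiters are the neighbours of `x` in
`# u x v #`. -/
def HasStructure (g : ContextFreeGrammar α) (M : OPMatrix α) : Prop :=
  ∀ u x v : List α, x ≠ [] → (g.IsConstituent u x v ↔ M.Chain u.getLast? x v.head?)

end ContextFreeGrammar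

/-- The operator precedence languages whose matrix is contained in `M`: the languages generated
by the operator precedence grammars `g` with `OPM(g) ⊆ M`. -/
def oplFamily {α : Type*} (M : OPMatrix α) : Set (Language α) :=
  {L | ∃ g : ContextFreeGrammar α, g.IsOPG ∧ g.opm.Contained M ∧ g.language = L}

/-- `F` is a Boolean algebra of languages (under union, intersection, and complement relative to
the top language `T`). -/
structure IsBooleanAlgebraOfLanguages {α : Type*} (F : Set (Language α)) (T : Language α) :
    Prop where
  top_mem : T ∈ F
  le_top : ∀ L ∈ F, L ≤ T
  bot_mem : ⊥ ∈ F
  union_mem : ∀ L₁ ∈ F, ∀ L₂ ∈ F, L₁ ⊔ L₂ ∈ F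
  inter_mem : ∀ L₁ ∈ F, ∀ L₂ ∈ F, L₁ ⊓ L₂ ∈ F
  compl_mem : ∀ L ∈ F, T \ L ∈ F

/-!
Let `M` be a conflict-free matrix. An operator precedence parser driven by `M` is deterministic, so
the skeleton of the syntax trees of a word is determined by the word and `M` alone.

Precisely, a nonempty word `w` derived in an operator grammar with matrix contained in `M` is a
chain body between the letters next to it (`gapIn_of_yields`), and its decomposition
`w = x₀ a₁ x₁ ⋯ aₙ xₙ` as a chain body is unique: it is the one that the parser follows
(`HeadRuns.unique`). Hence the first rule of a derivation of `w` that is not a renaming of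
nonterminals has the terminals `a₁, …, aₙ`, and its nonterminals derive the nonempty gaps `xᵢ`.
Consequently the set of rules of the grammar whose right-hand side derives `w` is a function of the
letters `aᵢ` and of the corresponding sets for the gaps `xᵢ` (`compositional_ruleSet`).

This allows for a subset construction. For a finite set `R` of words, and a map `val` from words to
a finite set that is computed bottom-up along chains in this way, `structureGrammar` has as
nonterminals the triples `(a, b, q)`, which generate exactly the chain bodies between `a` and `b` of
value `q` all of whose simple chains have letters in `R`. Keeping the neighbours `a` and `b` in the
nonterminals makes the matrix of this grammar contained in `M`
(`structureGrammar_opm_contained`). If `val` records the rules of two given grammars and `R`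
consists of the terminal parts of their right-hand sides, this yields union, intersection and difference
(`mem_oplFamily_of_boolean`). If `M` is `≐`-acyclic, there are finitely many simple chains, and `R`
can be the set of all of them; with a trivial `val` the grammar generates all words with a structure
according to `M`, which is the largest language of the family.

If `M` is complete, the parser never blocks, so all words have a structure (`Complete.chainGap`).
Let a grammar with matrix contained in `M` generate all words. Each two-letter word shows
that a cell of its matrix is not empty, so this matrix is `M`. Its constituents are chain bodies by
the above. Conversely, a run of the parser that starts within another one cannot outlast it
(`Pops.nested`, `Runs.nested`), so a chain body inside a word is the whole word or lies inside
one of the gaps of its decomposition; descending in the syntax tree, the occurrence is found as the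
frontier of a subtree (`exists_constituent`).
-/

namespace OPMatrix

variable {α : Type*}

/-! ### Chain bodies as data -/

/-- The word `x₀ a₁ x₁ ⋯ aₙ xₙ`, for `x = x₀` and `l = [(a₁, x₁), …, (aₙ, xₙ)]`. -/
def flat : List α → List (α × List α) → List α
  | x, [] => x
  | x, (c, y) :: l => x ++ c :: flat y l

/-- The gaps `x₀, …, xₙ` of the word `flat x₀ l`, each with its two neighbours; the word as a whole
has the neighbours `a` and `b`. -/
def gaps : Option α → List α → List (α × List α) → Option α →
    List (Option α × List α × Option α)
  | a, x, [], b => [(a, x, b)]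
  | a, x, (c, y) :: l, b => (a, x, some c) :: gaps (some c) y l b

/-- `SkelTail M a ls b`: with `ls = [a₂, …, aₙ]`, the relations `a ≐ a₂ ≐ ⋯ ≐ aₙ ⋗ b` hold. -/
def SkelTail (M : OPMatrix α) : α → List α → Option α → Prop
  | a, [], b => PrecRel.gt ∈ M.withDelim (some a) b
  | a, c :: l, b => PrecRel.eq ∈ M a c ∧ SkelTail M c l b

/-- `Skel M a ls b`: with `ls = [a₁, …, aₙ]`, the relations `a ⋖ a₁ ≐ ⋯ ≐ aₙ ⋗ b` hold
and `n ≥ 1`. -/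
def Skel (M : OPMatrix α) (a : Option α) : List α → Option α → Prop
  | [], _ => False
  | c :: l, b => PrecRel.lt ∈ M.withDelim a (some c) ∧ SkelTail M c l b

/-- `GapIn M R a x b`: the word `x` is empty or the body of a chain between `a` and `b`, where the
letters `a₁ ≐ ⋯ ≐ aₙ` of every simple chain involved form a word of `R`. -/
inductive GapIn (M : OPMatrix α) (R : Set (List α)) : Option α → List α → Option α → Prop
  | nil (a b : Option α) : GapIn M R a [] b
  | chain {a b : Option α} {x : List α} {l : List (α × List α)} :
      (M.withDelim a b).Nonempty → l.map Prod.fst ∈ R → Skel M a (l.map Prod.fst) b →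
      (∀ p ∈ gaps a x l b, GapIn M R p.1 p.2.1 p.2.2) → GapIn M R a (flat x l) b

variable {M : OPMatrix α} {R : Set (List α)}

theorem ConflictFree.withDelim (hM : M.ConflictFree) : M.withDelim.ConflictFree := by
  rintro (_ | a) (_ | b)
  · exact Set.subsingleton_singleton
  · exact Set.subsingleton_singleton
  · exact Set.subsingleton_singleton
  · exact hM a b

theorem ConflictFree.not_lt_of_gt (hM : M.ConflictFree) {a b : Option α}
    (h : PrecRel.gt ∈ M.withDelim a b) : PrecRel.lt ∉ M.withDelim a b :=
  fun h' => nomatch hM.withDelim a b h h'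

theorem ConflictFree.not_lt_of_eq (hM : M.ConflictFree) {a b : Option α}
    (h : PrecRel.eq ∈ M.withDelim a b) : PrecRel.lt ∉ M.withDelim a b :=
  fun h' => nomatch hM.withDelim a b h h'

theorem ConflictFree.not_gt_of_eq (hM : M.ConflictFree) {a b : Option α}
    (h : PrecRel.eq ∈ M.withDelim a b) : PrecRel.gt ∉ M.withDelim a b :=
  fun h' => nomatch hM.withDelim a b h h'

theorem lt_delim (c : α) : PrecRel.lt ∈ M.withDelim none (some c) := rfl

theorem gt_delim (c : α) : PrecRel.gt ∈ M.withDelim (some c) none := rfl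

theorem GapIn.mono {R' : Set (List α)} (hR : ∀ a ls b, Skel M a ls b → ls ∈ R → ls ∈ R')
    {a b : Option α} {x : List α} (h : GapIn M R a x b) : GapIn M R' a x b := by
  induction h with
  | nil a b => exact .nil a b
  | chain hn hl hs _ ih => exact .chain hn (hR _ _ _ hs hl) hs ih

theorem GapIn.exists_chain {a b : Option α} {w : List α} (h : GapIn M R a w b) (hw : w ≠ []) :
    (M.withDelim a b).Nonempty ∧ ∃ x l, w = flat x l ∧ l.map Prod.fst ∈ R ∧
      Skel M a (l.map Prod.fst) b ∧ ∀ p ∈ gaps a x l b, GapIn M R p.1 p.2.1 p.2.2 := by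
  cases h with
  | nil => exact absurd rfl hw
  | chain hn hl hs hg => exact ⟨hn, _, _, rfl, hl, hs, hg⟩

theorem flat_ne_nil {x : List α} {l : List (α × List α)} (hl : l ≠ []) : flat x l ≠ [] := by
  cases l with
  | nil => exact absurd rfl hl
  | cons p l => simp [flat]

theorem length_gap_le {a b : Option α} {x : List α} {l : List (α × List α)} :
    ∀ p ∈ gaps a x l b, p.2.1.length ≤ (flat x l).length := by
  induction l generalizing a x with
  | nil => simp [gaps, flat]
  | cons q l ih =>
    intro p hp
    simp only [gaps, List.mem_cons] at hp
    rcases hp with rfl | hp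
    · simp [flat]
    · have := ih p hp
      simp only [flat, List.length_append, List.length_cons]
      omega

/-- A gap of a chain body is shorter than the body. -/
theorem length_gap_lt {a b : Option α} {x : List α} {l : List (α × List α)} (hl : l ≠ []) :
    ∀ p ∈ gaps a x l b, p.2.1.length < (flat x l).length := by
  obtain ⟨q, l, rfl⟩ := List.exists_cons_of_ne_nil hl
  intro p hp
  simp only [gaps, List.mem_cons] at hp
  rcases hp with rfl | hp
  · simp only [flat, List.length_append, List.length_cons]
    omega
  · have := length_gap_le p hp
    simp only [flat, List.length_append, List.length_cons]
    omega

theorem Skel.ne_nil {a b : Option α} {l : List (α × List α)}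
    (h : Skel M a (l.map Prod.fst) b) : l ≠ [] := by
  rintro rfl
  exact h

/-- In a chain body, neighbouring letters at the top level are in some relation. -/
theorem nonempty_of_mem_gaps_tail {c : α} {b : Option α} {x : List α} {l : List (α × List α)}
    (h : SkelTail M c (l.map Prod.fst) b) :
    ∀ p ∈ gaps (some c) x l b, (M.withDelim p.1 p.2.2).Nonempty := by
  induction l generalizing c x with
  | nil =>
    intro p hp
    simp only [gaps, List.mem_singleton] at hp
    subst hp
    exact ⟨_, h⟩
  | cons q l ih =>
    intro p hp
    simp only [gaps, List.mem_cons] at hp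
    rcases hp with rfl | hp
    · exact ⟨_, h.1⟩
    · exact ih h.2 p hp

theorem nonempty_of_mem_gaps {a b : Option α} {x : List α} {l : List (α × List α)}
    (h : Skel M a (l.map Prod.fst) b) :
    ∀ p ∈ gaps a x l b, (M.withDelim p.1 p.2.2).Nonempty := by
  obtain ⟨q, l, rfl⟩ := List.exists_cons_of_ne_nil h.ne_nil
  intro p hp
  simp only [gaps, List.mem_cons] at hp
  rcases hp with rfl | hp
  · exact ⟨_, h.1⟩
  · exact nonempty_of_mem_gaps_tail h.2 p hp

/-! ### Comparison with the inductive definition of chains -/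

mutual

theorem Chain.gapIn {a b : Option α} {x : List α} (h : Chain M a x b) :
    GapIn M Set.univ a x b :=
  match h with
  | .intro hn hlt hg ht => by
    obtain ⟨x', l, rfl, hs, hl⟩ := ht.exists_flat
    refine GapIn.chain (l := (_, x') :: l) hn trivial ⟨hlt, hs⟩ ?_
    intro p hp
    simp only [gaps, List.mem_cons] at hp
    rcases hp with rfl | hp
    · exact hg.gapIn
    · exact hl p hp

theorem ChainTail.exists_flat {a : α} {y : List α} {b : Option α} (h : ChainTail M a y b) :
    ∃ x l, y = flat x l ∧ SkelTail M a (l.map Prod.fst) b ∧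
      ∀ p ∈ gaps (some a) x l b, GapIn M Set.univ p.1 p.2.1 p.2.2 :=
  match h with
  | .last (x := x) hgt hg => by
    have := hg.gapIn
    refine ⟨x, [], rfl, hgt, ?_⟩
    simpa [gaps] using this
  | .step (c := c) (x := x) heq hg ht => by
    obtain ⟨x', l, rfl, hs, hl⟩ := ht.exists_flat
    refine ⟨x, (c, x') :: l, rfl, ⟨heq, hs⟩, ?_⟩
    intro p hp
    simp only [gaps, List.mem_cons] at hp
    rcases hp with rfl | hp
    · exact hg.gapIn
    · exact hl p hp

theorem ChainGap.gapIn {a b : Option α} {x : List α} (h : ChainGap M a x b) :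
    GapIn M Set.univ a x b :=
  match h with
  | .nil => .nil _ _
  | .chain hc => hc.gapIn

end

theorem chainTail_flat {c : α} {b : Option α} {x : List α} {l : List (α × List α)}
    (hs : SkelTail M c (l.map Prod.fst) b)
    (hg : ∀ p ∈ gaps (some c) x l b, ChainGap M p.1 p.2.1 p.2.2) :
    ChainTail M c (flat x l) b := by
  induction l generalizing c x with
  | nil => exact .last hs (hg (some c, x, b) (by simp [gaps]))
  | cons q l ih =>
    simp only [gaps, List.forall_mem_cons] at hg
    exact .step hs.1 hg.1 (ih hs.2 hg.2)

theorem GapIn.chainGap {a b : Option α} {x : List α} (h : GapIn M R a x b) :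
    ChainGap M a x b := by
  induction h with
  | nil a b => exact .nil
  | @chain a b x l hn _ hs _ ih =>
    obtain ⟨q, l, rfl⟩ := List.exists_cons_of_ne_nil hs.ne_nil
    simp only [gaps, List.forall_mem_cons] at ih
    exact .chain (.intro hn hs.1 ih.1 (chainTail_flat hs.2 ih.2))

theorem ChainGap.chain_of_ne_nil {a b : Option α} {x : List α} (h : ChainGap M a x b)
    (hx : x ≠ []) : Chain M a x b := by
  cases h with
  | nil => exact absurd rfl hx
  | chain h => exact h

/-! ### Operator precedence parsing -/

/-- `Pops M a w z`: the operator precedence parser, with `a` on the top of its stack and `w` as the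
remaining input, removes the stack symbol of `a` when the remaining input is `z`. Meanwhile a
letter `c` with `a ≐ c` replaces `a`, and a letter `c` with `a ⋖ c` is pushed above `a`. -/
inductive Pops (M : OPMatrix α) : α → List α → List α → Prop
  | pop {a : α} {w : List α} : PrecRel.gt ∈ M.withDelim (some a) w.head? → Pops M a w w
  | shift {a c : α} {w z : List α} : PrecRel.eq ∈ M a c → Pops M c w z → Pops M a (c :: w) z
  | push {a c : α} {w z z' : List α} : PrecRel.lt ∈ M a c → Pops M c w z' → Pops M a z' z →
      Pops M a (c :: w) z

/-- `Runs M a w z`: the operator precedence parser, with `a` on the top of its stack (the stack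
being empty if `a` is the delimiter) and `w` as the remaining input, comes back to the same stack
after some pushes and the matching pops, with `z` as the remaining input. -/
inductive Runs (M : OPMatrix α) : Option α → List α → List α → Prop
  | refl {a : Option α} {w : List α} : Runs M a w w
  | push {a : Option α} {c : α} {w z z' : List α} : PrecRel.lt ∈ M.withDelim a (some c) →
      Pops M c w z' → Runs M a z' z → Runs M a (c :: w) z

theorem Pops.unique (hM : M.ConflictFree) {a : α} {w z z' : List α} (h : Pops M a w z)
    (h' : Pops M a w z') : z = z' := by
  induction h generalizing z' with
  | pop hgt =>
    cases h' with
    | pop => rfl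
    | shift h₁ => exact absurd hgt (hM.not_gt_of_eq h₁)
    | push h₁ => exact absurd h₁ (hM.not_lt_of_gt hgt)
  | shift heq _ ih =>
    cases h' with
    | pop hgt => exact absurd hgt (hM.not_gt_of_eq heq)
    | shift _ h₁ => exact ih h₁
    | push h₁ => exact absurd h₁ (hM.not_lt_of_eq (a := some _) (b := some _) heq)
  | push hlt _ _ ih₁ ih₂ =>
    cases h' with
    | pop hgt => exact absurd hlt (hM.not_lt_of_gt hgt)
    | shift h₁ => exact absurd hlt (hM.not_lt_of_eq (a := some _) (b := some _) h₁)
    | push _ h₁ h₂ =>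
      obtain rfl := ih₁ h₁
      exact ih₂ h₂

theorem Pops.suffix {a : α} {w z : List α} (h : Pops M a w z) : z <:+ w := by
  induction h with
  | pop => exact List.suffix_rfl
  | shift _ _ ih => exact ih.trans (List.suffix_cons _ _)
  | push _ _ _ ih₁ ih₂ => exact (ih₂.trans ih₁).trans (List.suffix_cons _ _)

theorem Runs.suffix {a : Option α} {w z : List α} (h : Runs M a w z) : z <:+ w := by
  induction h with
  | refl => exact List.suffix_rfl
  | push _ h _ ih => exact (ih.trans h.suffix).trans (List.suffix_cons _ _)

theorem Runs.trans {a : Option α} {w z z' : List α} (h : Runs M a w z) (h' : Runs M a z z') :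
    Runs M a w z' := by
  induction h with
  | refl => exact h'
  | push h₁ h₂ _ ih => exact .push h₁ h₂ (ih h')

theorem Runs.pops {a : α} {w z z' : List α} (h : Runs M (some a) w z) (h' : Pops M a z z') :
    Pops M a w z' := by
  generalize ha : some a = a' at h
  induction h with
  | refl => exact h'
  | push h₁ h₂ _ ih =>
    subst ha
    exact .push h₁ h₂ (ih h')

/-- The parser is deterministic, so one of two runs at the same level extends the other. -/
theorem Runs.linear (hM : M.ConflictFree) {a : Option α} {w z z' : List α} (h : Runs M a w z)
    (h' : Runs M a w z') : Runs M a z z' ∨ Runs M a z' z := by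
  induction h with
  | refl => exact .inl h'
  | push h₁ h₂ h₃ ih =>
    cases h' with
    | refl => exact .inr (.push h₁ h₂ h₃)
    | push _ h₂' h₃' =>
      obtain rfl := h₂.unique hM h₂'
      exact ih h₃'

theorem Runs.lt_head {a : Option α} {w z : List α} (h : Runs M a w z) (hne : w ≠ z) :
    PrecRel.lt ∈ M.withDelim a w.head? := by
  cases h with
  | refl => exact absurd rfl hne
  | push h₁ => exact h₁

theorem Runs.eq_of_not_lt {a : Option α} {w z : List α} (h : Runs M a w z)
    (hlt : PrecRel.lt ∉ M.withDelim a w.head?) : w = z :=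
  by_contra fun hne => hlt (h.lt_head hne)

/-! ### Decompositions followed by the parser -/

/-- `TailRuns M c x l z`: the parser, with `c` on the top of its stack and the input
`flat x l ++ z`, follows the decomposition `(x, l)` up to the pop in front of `z`. -/
def TailRuns (M : OPMatrix α) : α → List α → List (α × List α) → List α → Prop
  | c, x, [], z => PrecRel.gt ∈ M.withDelim (some c) z.head? ∧ Runs M (some c) (x ++ z) z
  | c, x, (d, y) :: l, z => PrecRel.eq ∈ M c d ∧
      Runs M (some c) (x ++ d :: (flat y l ++ z)) (d :: (flat y l ++ z)) ∧ TailRuns M d y l z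

/-- `HeadRuns M a x l z`: the parser, with `a` on the top of its stack and the input
`flat x l ++ z`, follows the decomposition `(x, l)` of a chain body in front of `z`. -/
def HeadRuns (M : OPMatrix α) (a : Option α) (x : List α) : List (α × List α) → List α → Prop
  | [], _ => False
  | (c, y) :: l, z => PrecRel.lt ∈ M.withDelim a (some c) ∧
      Runs M a (x ++ c :: (flat y l ++ z)) (c :: (flat y l ++ z)) ∧ TailRuns M c y l z

theorem flat_cons_append (x : List α) (c : α) (y : List α) (l : List (α × List α)) (z : List α) :
    flat x ((c, y) :: l) ++ z = x ++ c :: (flat y l ++ z) := by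
  simp [flat]

theorem TailRuns.pops {c : α} {x : List α} {l : List (α × List α)} {z : List α}
    (h : TailRuns M c x l z) : Pops M c (flat x l ++ z) z := by
  induction l generalizing c x with
  | nil => exact h.2.pops (.pop h.1)
  | cons q l ih =>
    obtain ⟨d, y⟩ := q
    rw [flat_cons_append]
    exact h.2.1.pops (.shift h.1 (ih h.2.2))

theorem HeadRuns.runs {a : Option α} {x : List α} {l : List (α × List α)} {z : List α}
    (h : HeadRuns M a x l z) : Runs M a (flat x l ++ z) z := by
  cases l with
  | nil => exact h.elim
  | cons q l =>
    obtain ⟨c, y⟩ := q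
    rw [flat_cons_append]
    exact h.2.1.trans (.push h.1 h.2.2.pops .refl)

theorem tailRuns_of_gaps {c : α} {b : Option α} {x z : List α} {l : List (α × List α)}
    (hs : SkelTail M c (l.map Prod.fst) b)
    (hz : ∀ d, PrecRel.gt ∈ M.withDelim (some d) b → PrecRel.gt ∈ M.withDelim (some d) z.head?)
    (hg : ∀ p ∈ gaps (some c) x l b, ∀ z' : List α,
      (∀ d, PrecRel.gt ∈ M.withDelim (some d) p.2.2 →
        PrecRel.gt ∈ M.withDelim (some d) z'.head?) → Runs M p.1 (p.2.1 ++ z') z') :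
    TailRuns M c x l z := by
  induction l generalizing c x with
  | nil => exact ⟨hz _ hs, hg (some c, x, b) (by simp [gaps]) z hz⟩
  | cons q l ih =>
    simp only [gaps, List.forall_mem_cons] at hg
    exact ⟨hs.1, hg.1 _ fun _ h => h, ih hs.2 hg.2⟩

theorem headRuns_of_gaps {a a' b : Option α} {x z : List α} {l : List (α × List α)}
    (hs : Skel M a (l.map Prod.fst) b)
    (ha : ∀ d, PrecRel.lt ∈ M.withDelim a (some d) → PrecRel.lt ∈ M.withDelim a' (some d))
    (hz : ∀ d, PrecRel.gt ∈ M.withDelim (some d) b → PrecRel.gt ∈ M.withDelim (some d) z.head?)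
    (hg : ∀ p ∈ gaps a x l b, ∀ (a' : Option α) (z' : List α),
      (∀ d, PrecRel.lt ∈ M.withDelim p.1 (some d) → PrecRel.lt ∈ M.withDelim a' (some d)) →
      (∀ d, PrecRel.gt ∈ M.withDelim (some d) p.2.2 →
        PrecRel.gt ∈ M.withDelim (some d) z'.head?) → Runs M a' (p.2.1 ++ z') z') :
    HeadRuns M a' x l z := by
  obtain ⟨q, l, rfl⟩ := List.exists_cons_of_ne_nil hs.ne_nil
  simp only [gaps, List.forall_mem_cons] at hg
  exact ⟨ha _ hs.1, hg.1 _ _ ha fun _ h => h,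
    tailRuns_of_gaps hs.2 hz fun p hp z' hz' => hg.2 p hp _ _ (fun _ h => h) hz'⟩

/-- The parser reads a chain body and comes back to the same stack. The neighbours `a` and `b` may
be replaced by `a'` and the first letter of `z`, as long as the relations `⋖` of `a` and the
relations `⋗` of `b` are kept; this is the case when delimiters replace them. -/
theorem GapIn.runs_of_imp {a b : Option α} {x : List α} (h : GapIn M R a x b) :
    ∀ (a' : Option α) (z : List α),
    (∀ d, PrecRel.lt ∈ M.withDelim a (some d) → PrecRel.lt ∈ M.withDelim a' (some d)) →
    (∀ d, PrecRel.gt ∈ M.withDelim (some d) b → PrecRel.gt ∈ M.withDelim (some d) z.head?) →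
    Runs M a' (x ++ z) z := by
  induction h with
  | nil a b => exact fun _ _ _ _ => .refl
  | chain _ _ hs _ ih => exact fun a' z ha hz => (headRuns_of_gaps hs ha hz ih).runs

theorem GapIn.runs {a b : Option α} {x : List α} (h : GapIn M R a x b) {z : List α}
    (hz : z.head? = b) : Runs M a (x ++ z) z :=
  h.runs_of_imp a z (fun _ h => h) (by rw [hz]; exact fun _ h => h)

/-- A chain decomposition does not depend on the neighbours of the chain: the parser also follows it
between delimiters. -/
theorem headRuns_delim {a b : Option α} {x : List α} {l : List (α × List α)}
    (hs : Skel M a (l.map Prod.fst) b) (hg : ∀ p ∈ gaps a x l b, GapIn M R p.1 p.2.1 p.2.2) :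
    HeadRuns M none x l [] :=
  headRuns_of_gaps hs (fun d _ => lt_delim d) (fun d _ => gt_delim d)
    fun p hp => (hg p hp).runs_of_imp

theorem headRuns_of_gapIn {a b : Option α} {x z : List α} {l : List (α × List α)}
    (hs : Skel M a (l.map Prod.fst) b) (hg : ∀ p ∈ gaps a x l b, GapIn M R p.1 p.2.1 p.2.2)
    (hz : z.head? = b) : HeadRuns M a x l z :=
  headRuns_of_gaps hs (fun _ h => h) (by rw [hz]; exact fun _ h => h)
    fun p hp => (hg p hp).runs_of_imp

/-- A run that cannot be prolonged is determined by its start. -/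
theorem Runs.unique (hM : M.ConflictFree) {a : Option α} {w z z' : List α} (h : Runs M a w z)
    (h' : Runs M a w z') (hz : PrecRel.lt ∉ M.withDelim a z.head?)
    (hz' : PrecRel.lt ∉ M.withDelim a z'.head?) : z = z' := by
  rcases h.linear hM h' with h | h
  · exact h.eq_of_not_lt hz
  · exact (h.eq_of_not_lt hz').symm

theorem TailRuns.unique (hM : M.ConflictFree) {c : α} {x x' z : List α}
    {l l' : List (α × List α)} (h : TailRuns M c x l z) (h' : TailRuns M c x' l' z)
    (hf : flat x l = flat x' l') : x = x' ∧ l = l' := by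
  induction l generalizing c x x' l' with
  | nil =>
    cases l' with
    | nil => exact ⟨hf, rfl⟩
    | cons q l' =>
      obtain ⟨d, y⟩ := q
      have h₁ := h.2
      have h₂ := h'.2.1
      rw [← flat_cons_append, ← hf] at h₂
      have := congrArg List.length
        (h₁.unique hM h₂ (hM.not_lt_of_gt h.1) (hM.not_lt_of_eq (a := some _) (b := some _) h'.1))
      simp at this
      omega
  | cons q l ih =>
    obtain ⟨d, y⟩ := q
    have h₁ := h.2.1
    rw [← flat_cons_append] at h₁
    have hlt := hM.not_lt_of_eq (a := some _) (b := some _) h.1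
    cases l' with
    | nil =>
      have h₂ := h'.2
      change Runs M (some c) (flat x' [] ++ z) z at h₂
      rw [← hf] at h₂
      have := congrArg List.length (h₁.unique hM h₂ hlt (hM.not_lt_of_gt h'.1))
      simp at this
      omega
    | cons q l' =>
      obtain ⟨d', y'⟩ := q
      have h₂ := h'.2.1
      rw [← flat_cons_append, ← hf] at h₂
      have := h₁.unique hM h₂ hlt (hM.not_lt_of_eq (a := some _) (b := some _) h'.1)
      simp only [List.cons.injEq, List.append_cancel_right_eq] at this
      obtain ⟨rfl, he⟩ := this
      simp only [flat, he, List.append_cancel_right_eq] at hf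
      obtain ⟨rfl, rfl⟩ := ih h.2.2 h'.2.2 he
      exact ⟨hf, rfl⟩

theorem Runs.eq_or_push {a : Option α} {w z : List α} (h : Runs M a w z) :
    w = z ∨ ∃ c w' z', w = c :: w' ∧ PrecRel.lt ∈ M.withDelim a (some c) ∧ Pops M c w' z' ∧
      Runs M a z' z := by
  cases h with
  | refl => exact .inl rfl
  | push h₁ h₂ h₃ => exact .inr ⟨_, _, _, rfl, h₁, h₂, h₃⟩

theorem HeadRuns.eq_of_runs (hM : M.ConflictFree) {a : Option α} {x x' z : List α}
    {c c' : α} {y y' : List α} {l l' : List (α × List α)} (h : HeadRuns M a x ((c, y) :: l) z)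
    (h' : HeadRuns M a x' ((c', y') :: l') z)
    (hf : flat x ((c, y) :: l) = flat x' ((c', y') :: l'))
    (hr : Runs M a (c :: (flat y l ++ z)) (c' :: (flat y' l' ++ z))) :
    x = x' ∧ (c, y) :: l = (c', y') :: l' := by
  rcases hr.eq_or_push with he | ⟨d, w, z', hw, -, hp, hr⟩
  · simp only [List.cons.injEq, List.append_cancel_right_eq] at he
    obtain ⟨rfl, he⟩ := he
    simp only [flat, he, List.append_cancel_right_eq] at hf
    obtain ⟨rfl, rfl⟩ := h.2.2.unique hM h'.2.2 he
    exact ⟨hf, rfl⟩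
  · obtain ⟨rfl, rfl⟩ := List.cons.inj hw
    obtain rfl := hp.unique hM h.2.2.pops
    have := hr.suffix.length_le
    simp at this

/-- A word has at most one decomposition as a chain body: the one found by the parser. -/
theorem HeadRuns.unique (hM : M.ConflictFree) {a : Option α} {x x' z : List α}
    {l l' : List (α × List α)} (h : HeadRuns M a x l z) (h' : HeadRuns M a x' l' z)
    (hf : flat x l = flat x' l') : x = x' ∧ l = l' := by
  obtain - | ⟨⟨c, y⟩, l⟩ := l
  · exact h.elim
  obtain - | ⟨⟨c', y'⟩, l'⟩ := l'
  · exact h'.elim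
  have h₁ := h.2.1
  have h₂ := h'.2.1
  rw [← flat_cons_append] at h₁ h₂
  rw [← hf] at h₂
  rcases h₁.linear hM h₂ with hr | hr
  · exact h.eq_of_runs hM h' hf hr
  · obtain ⟨h₁, h₂⟩ := h'.eq_of_runs hM h hf.symm hr
    exact ⟨h₁.symm, h₂.symm⟩

/-! ### Nested chains -/

theorem getLast?_append_or (p u : List α) (a : Option α) :
    (p ++ u).getLast?.or a = u.getLast?.or (p.getLast?.or a) := by
  simp [List.getLast?_append, Option.or_assoc]

theorem or_getLast?_cons (c : α) (u : List α) (a : Option α) :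
    (c :: u).getLast?.or a = u.getLast?.or (some c) := by
  simpa using getLast?_append_or [c] u a

theorem getLast?_or_congr {u : List α} (hu : u ≠ []) (a b : Option α) :
    u.getLast?.or a = u.getLast?.or b := by
  simp [List.getLast?_eq_some_getLast hu]

/-- A run that starts while the parser reads the letters consumed before the pop of `e` ends no
later than that pop. -/
theorem Pops.nested (hM : M.ConflictFree) {e : α} {w z : List α} (h : Pops M e w z) :
    ∀ {u x v : List α}, w = u ++ x ++ v → u.length + z.length ≤ w.length → x ≠ [] →
      Runs M (u.getLast?.or (some e)) (x ++ v) v → z.length ≤ v.length := by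
  induction h with
  | pop hgt =>
    intro u x v hw hu hx hr
    obtain rfl : u = [] := List.eq_nil_of_length_eq_zero (by omega)
    have := hr.lt_head (by simpa using hx)
    subst hw
    exact absurd this (hM.not_lt_of_gt (by simpa using hgt))
  | @shift a c w z heq hp ih =>
    intro u x v hw hu hx hr
    obtain - | ⟨d, u⟩ := u
    · have := hr.lt_head (by simpa using hx)
      simp only [List.nil_append] at hw
      rw [← hw] at this
      exact absurd this (hM.not_lt_of_eq (a := some _) (b := some _) heq)
    · simp only [List.cons_append, List.cons.injEq] at hw
      obtain ⟨rfl, hw⟩ := hw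
      rw [or_getLast?_cons] at hr
      exact ih hw (by simp at hu; omega) hx hr
  | @push a c w z z' hlt hp hp' ih₁ ih₂ =>
    intro u x v hw hu hx hr
    have hz := hp'.suffix.length_le
    obtain - | ⟨d, u⟩ := u
    · simp only [List.nil_append] at hw
      rw [← hw] at hr
      rcases hr.eq_or_push with he | ⟨d, w', z₁, he, -, h₁, h₂⟩
      · rw [hw] at he
        exact absurd he (by simpa using hx)
      · obtain ⟨rfl, rfl⟩ := List.cons.inj he
        obtain rfl := hp.unique hM h₁
        by_cases hv : z' = v
        · rw [← hv]; exact hz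
        · obtain ⟨x', hx'⟩ := h₂.suffix
          refine ih₂ (u := []) (x := x') (v := v) (by simp [hx']) (by simpa using hz) ?_ ?_
          · rintro rfl
            exact hv hx'.symm
          · simpa [hx'] using h₂
    · simp only [List.cons_append, List.cons.injEq] at hw
      obtain ⟨rfl, hw⟩ := hw
      rw [or_getLast?_cons] at hr
      by_cases hl : u.length + z'.length ≤ w.length
      · exact hz.trans (ih₁ hw hl hx hr)
      · obtain ⟨y, rfl⟩ := hp.suffix
        have hyu : y <+: u := by
          refine List.prefix_of_prefix_length_le (l₃ := y ++ z') ⟨z', rfl⟩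
            ⟨x ++ v, by simpa using hw.symm⟩ ?_
          simp at hl
          omega
        obtain ⟨u', rfl⟩ := hyu
        have hne : u' ≠ [] := by
          rintro rfl
          simp at hl
        refine ih₂ (u := u') (x := x) (v := v) (by simpa using hw) ?_ hx ?_
        · simp at hu
          omega
        · rwa [getLast?_append_or, getLast?_or_congr hne] at hr

/-- A run that starts strictly inside another run, or at its beginning when the latter cannot be
prolonged, ends no later than the latter. -/
theorem Runs.nested (hM : M.ConflictFree) {a : Option α} {w z : List α} (h : Runs M a w z) :
    ∀ {u x v : List α}, w = u ++ x ++ v → u.length + z.length ≤ w.length → x ≠ [] →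
      (u ≠ [] ∨ PrecRel.lt ∉ M.withDelim a z.head?) →
      Runs M (u.getLast?.or a) (x ++ v) v → z.length ≤ v.length := by
  induction h with
  | refl =>
    intro u x v hw hu hx hor hr
    obtain rfl : u = [] := List.eq_nil_of_length_eq_zero (by omega)
    have := hr.lt_head (by simpa using hx)
    subst hw
    simp at hor this
    exact absurd this hor
  | @push c w z z' hlt hp hp' ih =>
    intro u x v hw hu hx hor hr
    have hz := hp'.suffix.length_le
    obtain - | ⟨d, u⟩ := u
    · simp only [ne_eq, not_true_eq_false, false_or] at hor
      simp only [List.nil_append] at hw hr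
      rw [← hw] at hr
      rcases (Runs.push hlt hp hp').linear hM hr with h | h
      · rw [h.eq_of_not_lt hor]
      · exact h.suffix.length_le
    · simp only [List.cons_append, List.cons.injEq] at hw
      obtain ⟨rfl, hw⟩ := hw
      rw [or_getLast?_cons] at hr
      by_cases hl : u.length + z'.length ≤ w.length
      · exact hz.trans (hp.nested hM hw hl hx hr)
      · obtain ⟨y, rfl⟩ := hp.suffix
        have hyu : y <+: u := by
          refine List.prefix_of_prefix_length_le (l₃ := y ++ z') ⟨z', rfl⟩
            ⟨x ++ v, by simpa using hw.symm⟩ ?_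
          simp at hl
          omega
        obtain ⟨u', rfl⟩ := hyu
        have hne : u' ≠ [] := by
          rintro rfl
          simp at hl
        refine ih (u := u') (x := x) (v := v) (by simpa using hw) ?_ hx (.inl hne) ?_
        · simp at hu
          omega
        · rwa [getLast?_append_or, getLast?_or_congr hne] at hr

/-! ### Complete matrices -/

theorem Complete.withDelim (hM : M.Complete) (a b : Option α) : (M.withDelim a b).Nonempty := by
  rcases a with _ | a <;> rcases b with _ | b
  · exact ⟨_, rfl⟩
  · exact ⟨_, rfl⟩
  · exact ⟨_, rfl⟩
  · exact hM a b

/-- Over a complete matrix the parser never blocks: below `a` it can read chains until the next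
letter is not in relation `⋖`, and it can proceed from any letter `a` up to the pop of `a`. -/
theorem Complete.exists_gap_tail (hM : M.Complete) (w : List α) :
    (∀ (a : Option α) (x : List α), ChainGap M a x w.head? → ∃ y z, w = y ++ z ∧
      ChainGap M a (x ++ y) z.head? ∧ PrecRel.lt ∉ M.withDelim a z.head?) ∧
    ∀ a : α, ∃ y z, w = y ++ z ∧ ChainTail M a y z.head? := by
  induction hn : w.length using Nat.strong_induction_on generalizing w with
  | _ n ih =>
  have hgap : ∀ (a : Option α) (x : List α), ChainGap M a x w.head? → ∃ y z, w = y ++ z ∧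
      ChainGap M a (x ++ y) z.head? ∧ PrecRel.lt ∉ M.withDelim a z.head? := by
    intro a x hx
    by_cases hlt : PrecRel.lt ∈ M.withDelim a w.head?
    · obtain - | ⟨c, w⟩ := w
      · cases a <;> exact nomatch hlt
      obtain ⟨y, z, rfl, ht⟩ := (ih w.length (by simp [← hn]) w rfl).2 c
      obtain ⟨y', z', rfl, hg, hlt'⟩ := (ih z.length (by simp [← hn]) z rfl).1 a
        (x ++ c :: y) (.chain (.intro (hM.withDelim _ _) hlt hx ht))
      exact ⟨c :: y ++ y', z', by simp, by simpa using hg, hlt'⟩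
    · exact ⟨[], w, rfl, by simpa using hx, hlt⟩
  refine ⟨hgap, fun a => ?_⟩
  obtain ⟨y, z, rfl, hg, hlt⟩ := hgap (some a) [] .nil
  simp only [List.nil_append] at hg
  obtain ⟨ρ, hρ⟩ := hM.withDelim (some a) z.head?
  match ρ, hρ with
  | .lt, hρ => exact absurd hρ hlt
  | .gt, hρ => exact ⟨y, z, rfl, .last hρ hg⟩
  | .eq, hρ =>
    obtain - | ⟨c, z⟩ := z
    · exact nomatch hρ
    obtain ⟨y', z', rfl, ht⟩ := (ih z.length (by simp [← hn]; omega) z rfl).2 c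
    exact ⟨y ++ c :: y', z', by simp, .step hρ hg ht⟩

theorem Complete.chainGap (hM : M.Complete) (w : List α) : ChainGap M none w none := by
  obtain ⟨y, z, rfl, hg, hlt⟩ := (hM.exists_gap_tail w).1 none [] .nil
  obtain - | ⟨c, z⟩ := z
  · simpa using hg
  · exact absurd (lt_delim c) hlt

end OPMatrix

namespace ContextFreeGrammar

variable {α : Type*} {g : ContextFreeGrammar α}

open OPMatrix

/-! ### Derivations of words -/

/-- `g.Yields s w`: the string `s` derives the word `w`. The derivation is recorded as the forest of
the syntax trees that grow from the symbols of `s`. -/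
inductive Yields (g : ContextFreeGrammar α) : List (Symbol α g.NT) → List α → Prop
  | nil : Yields g [] []
  | terminal (a : α) {s : List (Symbol α g.NT)} {w : List α} :
      Yields g s w → Yields g (Symbol.terminal a :: s) (a :: w)
  | nonterminal {r : ContextFreeRule α g.NT} {s : List (Symbol α g.NT)} {w w' : List α} :
      r ∈ g.rules → Yields g r.output w → Yields g s w' →
      Yields g (Symbol.nonterminal r.input :: s) (w ++ w')

theorem derives_rule {r : ContextFreeRule α g.NT} (hr : r ∈ g.rules) :
    g.Derives [Symbol.nonterminal r.input] r.output :=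
  Produces.single ⟨r, hr, ContextFreeRule.Rewrites.input_output⟩

theorem Derives.append {s s' t t' : List (Symbol α g.NT)} (h : g.Derives s s')
    (h' : g.Derives t t') : g.Derives (s ++ t) (s' ++ t') :=
  (h.append_right t).trans (h'.append_left s')

theorem Yields.derives {s : List (Symbol α g.NT)} {w : List α} (h : g.Yields s w) :
    g.Derives s (w.map Symbol.terminal) := by
  induction h with
  | nil => rfl
  | terminal a _ ih => exact ih.append_left [_]
  | nonterminal hr _ _ ih₁ ih₂ =>
    rw [List.map_append]
    exact ((derives_rule hr).trans ih₁).append ih₂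

theorem Yields.append {s t : List (Symbol α g.NT)} {w w' : List α} (h : g.Yields s w)
    (h' : g.Yields t w') : g.Yields (s ++ t) (w ++ w') := by
  induction h with
  | nil => exact h'
  | terminal a _ ih => exact .terminal a ih
  | nonterminal hr h₁ _ _ ih =>
    rw [List.append_assoc]
    exact .nonterminal hr h₁ ih

theorem Yields.exists_of_append {s t : List (Symbol α g.NT)} {w : List α}
    (h : g.Yields (s ++ t) w) : ∃ w₁ w₂, w = w₁ ++ w₂ ∧ g.Yields s w₁ ∧ g.Yields t w₂ := by
  induction s generalizing w with
  | nil => exact ⟨[], w, rfl, .nil, h⟩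
  | cons x s ih =>
    cases h with
    | terminal a h =>
      obtain ⟨w₁, w₂, rfl, h₁, h₂⟩ := ih h
      exact ⟨a :: w₁, w₂, rfl, .terminal a h₁, h₂⟩
    | nonterminal hr h₀ h =>
      obtain ⟨w₁, w₂, rfl, h₁, h₂⟩ := ih h
      exact ⟨_ ++ w₁, w₂, by simp, .nonterminal hr h₀ h₁, h₂⟩

theorem yields_nonterminal_iff {A : g.NT} {w : List α} :
    g.Yields [Symbol.nonterminal A] w ↔ ∃ r ∈ g.rules, r.input = A ∧ g.Yields r.output w := by
  constructor
  · intro h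
    cases h with
    | nonterminal hr h h' =>
      cases h'
      exact ⟨_, hr, rfl, by simpa using h⟩
  · rintro ⟨r, hr, rfl, h⟩
    simpa using Yields.nonterminal hr h .nil

theorem Yields.eq_nil {w : List α} (h : g.Yields [] w) : w = [] := by
  cases h
  rfl

theorem Yields.exists_of_terminal {c : α} {s : List (Symbol α g.NT)} {w : List α}
    (h : g.Yields (Symbol.terminal c :: s) w) : ∃ w', w = c :: w' ∧ g.Yields s w' := by
  cases h with
  | terminal _ h => exact ⟨_, rfl, h⟩

theorem yields_map_terminal (w : List α) : g.Yields (w.map Symbol.terminal) w := by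
  induction w with
  | nil => exact .nil
  | cons a w ih => exact .terminal a ih

theorem Yields.of_derives {s : List (Symbol α g.NT)} {w : List α}
    (h : g.Derives s (w.map Symbol.terminal)) : g.Yields s w := by
  induction h using Relation.ReflTransGen.head_induction_on with
  | refl => exact yields_map_terminal w
  | head h _ ih =>
    obtain ⟨r, hr, h⟩ := h
    obtain ⟨p, q, rfl, rfl⟩ := h.exists_parts
    obtain ⟨w', w₃, rfl, h', h₃⟩ := ih.exists_of_append
    obtain ⟨w₁, w₂, rfl, h₁, h₂⟩ := h'.exists_of_append
    exact (h₁.append (yields_nonterminal_iff.2 ⟨r, hr, rfl, h₂⟩)).append h₃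

theorem yields_iff {s : List (Symbol α g.NT)} {w : List α} :
    g.Yields s w ↔ g.Derives s (w.map Symbol.terminal) :=
  ⟨Yields.derives, Yields.of_derives⟩

theorem mem_language_iff_yields {w : List α} :
    w ∈ g.language ↔ ∃ r ∈ g.rules, r.input = g.initial ∧ g.Yields r.output w := by
  rw [mem_language_iff, ← yields_iff, yields_nonterminal_iff]

/-! ### The top level of a derivation -/

/-- `g.GapMatch β x`: either `β` and `x` are both empty, or `β` is a nonterminal that derives
the word `x`. -/
def GapMatch (g : ContextFreeGrammar α) (β : List (Symbol α g.NT)) (x : List α) : Prop :=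
  (β = [] ∧ x = []) ∨ ∃ r ∈ g.rules, β = [Symbol.nonterminal r.input] ∧ g.Yields r.output x

/-- `g.Match s x l`: the string `s` derives the word `flat x l` in such a way that its terminals
are the letters of `l` and its nonterminals derive the gaps in between. -/
def Match (g : ContextFreeGrammar α) : List (Symbol α g.NT) → List α → List (α × List α) → Prop
  | s, x, [] => g.GapMatch s x
  | s, x, (c, y) :: l => ∃ β s', s = β ++ Symbol.terminal c :: s' ∧ g.GapMatch β x ∧
      Match g s' y l

/-- The word formed by the terminals of a string. -/
def letters {N : Type*} (s : List (Symbol α N)) : List α :=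
  s.filterMap fun
    | .terminal a => some a
    | .nonterminal _ => none

/-- The words formed by the terminals of the right-hand sides of the rules. -/
def skeletons (g : ContextFreeGrammar α) : Set (List α) :=
  (fun r => letters r.output) '' (g.rules : Set (ContextFreeRule α g.NT))

theorem finite_skeletons (g : ContextFreeGrammar α) : g.skeletons.Finite :=
  g.rules.finite_toSet.image _

theorem GapMatch.isOptNonterminal {β : List (Symbol α g.NT)} {x : List α}
    (h : g.GapMatch β x) : IsOptNonterminal β := by
  rcases h with ⟨h, _⟩ | ⟨r, _, h, _⟩
  · exact .inl h
  · exact .inr ⟨_, h⟩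

theorem GapMatch.yields {β : List (Symbol α g.NT)} {x : List α} (h : g.GapMatch β x) :
    g.Yields β x := by
  rcases h with ⟨rfl, rfl⟩ | ⟨r, hr, rfl, h⟩
  · exact .nil
  · exact yields_nonterminal_iff.2 ⟨r, hr, rfl, h⟩

theorem letters_of_isOptNonterminal {N : Type*} {β : List (Symbol α N)}
    (h : IsOptNonterminal β) : letters β = [] := by
  rcases h with rfl | ⟨B, rfl⟩ <;> rfl

theorem terminal_notMem_of_isOptNonterminal {N : Type*} {β : List (Symbol α N)}
    (h : IsOptNonterminal β) (c : α) : Symbol.terminal c ∉ β := by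
  rcases h with rfl | ⟨B, rfl⟩ <;> simp

theorem Match.yields {s : List (Symbol α g.NT)} {x : List α} {l : List (α × List α)}
    (h : g.Match s x l) : g.Yields s (flat x l) := by
  induction l generalizing s x with
  | nil => exact GapMatch.yields h
  | cons q l ih =>
    obtain ⟨β, s', rfl, hβ, hs⟩ := h
    exact hβ.yields.append (.terminal _ (ih hs))

theorem Match.letters_eq {s : List (Symbol α g.NT)} {x : List α} {l : List (α × List α)}
    (h : g.Match s x l) : letters s = l.map Prod.fst := by
  induction l generalizing s x with
  | nil => exact letters_of_isOptNonterminal (GapMatch.isOptNonterminal h)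
  | cons q l ih =>
    obtain ⟨β, s', rfl, hβ, hs⟩ := h
    have := letters_of_isOptNonterminal hβ.isOptNonterminal
    simp only [letters, List.map_cons] at ih this ⊢
    simp [this, ih hs]

theorem Yields.exists_match {s : List (Symbol α g.NT)} {w : List α} (h : g.Yields s w)
    (hs : ∀ β γ B C, s ≠ β ++ [Symbol.nonterminal B, Symbol.nonterminal C] ++ γ) :
    ∃ x l, w = flat x l ∧ g.Match s x l := by
  induction h with
  | nil => exact ⟨[], [], rfl, .inl ⟨rfl, rfl⟩⟩
  | terminal a _ ih =>
    obtain ⟨x, l, rfl, hm⟩ := ih fun β γ B C h => hs (Symbol.terminal a :: β) γ B C (by simp [h])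
    exact ⟨[], (a, x) :: l, rfl, [], _, rfl, .inl ⟨rfl, rfl⟩, hm⟩
  | @nonterminal r s w w' hr h₁ h₂ _ ih =>
    obtain ⟨x, l, rfl, hm⟩ := ih fun β γ B C h =>
      hs (Symbol.nonterminal r.input :: β) γ B C (by simp [h])
    have hw : g.GapMatch [Symbol.nonterminal r.input] w := .inr ⟨r, hr, rfl, h₁⟩
    cases l with
    | nil =>
      rcases hm with ⟨rfl, rfl⟩ | ⟨r', -, rfl, -⟩
      · exact ⟨w, [], by simp [flat], hw⟩
      · exact absurd rfl (hs [] [] _ _)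
    | cons q l =>
      obtain ⟨β, s', rfl, ⟨rfl, rfl⟩ | ⟨r', -, rfl, -⟩, hs'⟩ := hm
      · exact ⟨w, q :: l, by simp [flat], [Symbol.nonterminal r.input], s', rfl, hw, hs'⟩
      · exact absurd rfl (hs [] _ _ _)

theorem Yields.exists_match_of_ne_nil (hg : g.IsOperator) {s : List (Symbol α g.NT)} {w : List α}
    (h : g.Yields s w) (hs : ∃ r ∈ g.rules, s = r.output) (hw : w ≠ []) :
    ∃ r ∈ g.rules, g.Derives s r.output ∧ ∃ x l, l ≠ [] ∧ w = flat x l ∧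
      g.Match r.output x l := by
  induction h with
  | nil => exact absurd rfl hw
  | terminal a h _ =>
    obtain ⟨r, hr, he⟩ := hs
    obtain ⟨x, l, hf, hm⟩ := (h.terminal a).exists_match (he ▸ hg r hr)
    refine ⟨r, hr, he ▸ Derives.refl _, x, l, ?_, hf, he ▸ hm⟩
    rintro rfl
    rcases hm with ⟨h, -⟩ | ⟨r', -, h, -⟩ <;> simp at h
  | @nonterminal r' s w w' hr' h₁ h₂ ih _ =>
    obtain ⟨r, hr, he⟩ := hs
    obtain ⟨x, l, hf, hm⟩ := (Yields.nonterminal hr' h₁ h₂).exists_match (he ▸ hg r hr)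
    by_cases hl : l = []
    · subst hl
      obtain ⟨h, -⟩ | ⟨r'', -, h, -⟩ := hm
      · simp at h
      · obtain rfl : s = [] := by simpa using (List.cons.inj h).2
        cases h₂
        simp only [List.append_nil] at hw ⊢
        obtain ⟨r₁, hr₁, hd, hx⟩ := ih ⟨r', hr', rfl⟩ hw
        exact ⟨r₁, hr₁, (derives_rule hr').trans hd, hx⟩
    · exact ⟨r, hr, he ▸ Derives.refl _, x, l, hl, hf, he ▸ hm⟩

/-- A nonempty word derived from a right-hand side decomposes along the first rule that is not a
renaming of nonterminals. -/
theorem exists_match_of_rule (hg : g.IsOperator) {r : ContextFreeRule α g.NT} (hr : r ∈ g.rules)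
    {w : List α} (h : g.Yields r.output w) (hw : w ≠ []) :
    ∃ r' ∈ g.rules, g.Derives r.output r'.output ∧ ∃ x l, l ≠ [] ∧ w = flat x l ∧
      g.Match r'.output x l :=
  h.exists_match_of_ne_nil hg ⟨r, hr, rfl⟩ hw

/-! ### Syntax trees follow the matrix -/

/-- The string `s` may stand to the right of `a`: every terminal that can appear first in what `s`
derives, possibly after a nonterminal, is in relation `⋖` with `a`. -/
def LeftOK (g : ContextFreeGrammar α) (M : OPMatrix α) (a : Option α)
    (s : List (Symbol α g.NT)) : Prop :=
  ∀ c β γ, IsOptNonterminal β → g.Derives s (β ++ [Symbol.terminal c] ++ γ) →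
    PrecRel.lt ∈ M.withDelim a (some c)

/-- The string `s` may stand to the left of `b`: every terminal that can appear last in what `s`
derives, possibly before a nonterminal, is in relation `⋗` with `b`. -/
def RightOK (g : ContextFreeGrammar α) (M : OPMatrix α) (s : List (Symbol α g.NT))
    (b : Option α) : Prop :=
  ∀ c γ β, IsOptNonterminal β → g.Derives s (γ ++ [Symbol.terminal c] ++ β) →
    PrecRel.gt ∈ M.withDelim (some c) b

variable {M : OPMatrix α}

theorem LeftOK.of_derives {a : Option α} {s t : List (Symbol α g.NT)} (h : g.LeftOK M a s)
    (hd : g.Derives s t) : g.LeftOK M a t :=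
  fun c β γ hβ ht => h c β γ hβ (hd.trans ht)

theorem RightOK.of_derives {b : Option α} {s t : List (Symbol α g.NT)} (h : g.RightOK M s b)
    (hd : g.Derives s t) : g.RightOK M t b :=
  fun c β γ hβ ht => h c β γ hβ (hd.trans ht)

theorem leftOK_delim (s : List (Symbol α g.NT)) : g.LeftOK M none s := fun c _ _ _ _ => lt_delim c

theorem rightOK_delim (s : List (Symbol α g.NT)) : g.RightOK M s none :=
  fun c _ _ _ _ => gt_delim c

theorem RightOK.of_append {b : Option α} {s t : List (Symbol α g.NT)}
    (h : g.RightOK M (s ++ t) b) : g.RightOK M t b :=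
  fun c γ β hβ ht => h c (s ++ γ) β hβ (by simpa using ht.append_left s)

theorem LeftOK.of_append {a : Option α} {s t : List (Symbol α g.NT)}
    (h : g.LeftOK M a (s ++ t)) : g.LeftOK M a s :=
  fun c β γ hβ hs => h c β (γ ++ t) hβ (by simpa using hs.append_right t)

theorem leftOK_of_rule (hgM : g.opm.Contained M) {r : ContextFreeRule α g.NT} (hr : r ∈ g.rules)
    {p q : List (Symbol α g.NT)} {c : α} {A : g.NT}
    (h : r.output = p ++ [Symbol.terminal c, Symbol.nonterminal A] ++ q) :
    g.LeftOK M (some c) [Symbol.nonterminal A] :=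
  fun _ β γ hβ hd => hgM _ _ (show PrecRel.lt ∈ g.opm _ _ from
    ⟨r, hr, p, q, A, h, β, γ, hβ, hd⟩)

theorem rightOK_of_rule (hgM : g.opm.Contained M) {r : ContextFreeRule α g.NT} (hr : r ∈ g.rules)
    {p q : List (Symbol α g.NT)} {c : α} {A : g.NT}
    (h : r.output = p ++ [Symbol.nonterminal A, Symbol.terminal c] ++ q) :
    g.RightOK M [Symbol.nonterminal A] (some c) :=
  fun _ γ β hβ hd => hgM _ _ (show PrecRel.gt ∈ g.opm _ _ from
    ⟨r, hr, p, q, A, h, γ, β, hβ, hd⟩)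

/-- The gap `p = (a, x, b)` is empty or is filled, in a suitable context, by a right-hand side
that derives `x`. -/
def Filled (g : ContextFreeGrammar α) (M : OPMatrix α) (p : Option α × List α × Option α) : Prop :=
  p.2.1 = [] ∨ ∃ r ∈ g.rules, g.Yields r.output p.2.1 ∧ g.LeftOK M p.1 r.output ∧
    g.RightOK M r.output p.2.2

theorem GapMatch.filled {a b : Option α} {β : List (Symbol α g.NT)} {x : List α}
    (h : g.GapMatch β x) (ha : g.LeftOK M a β) (hb : g.RightOK M β b) :
    g.Filled M (a, x, b) := by
  rcases h with ⟨-, h⟩ | ⟨r, hr, rfl, h⟩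
  · exact .inl h
  · exact .inr ⟨r, hr, h, ha.of_derives (derives_rule hr), hb.of_derives (derives_rule hr)⟩

theorem leftOK_gap (hgM : g.opm.Contained M) {r : ContextFreeRule α g.NT} (hr : r ∈ g.rules)
    {p q β : List (Symbol α g.NT)} {c : α} {x : List α} (hβ : g.GapMatch β x)
    (h : r.output = p ++ Symbol.terminal c :: (β ++ q)) : g.LeftOK M (some c) β := by
  rcases hβ with ⟨rfl, -⟩ | ⟨r', -, rfl, -⟩
  · intro d β γ _ hd
    rcases hd.eq_or_head with hd | ⟨v, ⟨r, -, hv⟩, -⟩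
    · simp at hd
    · nomatch hv
  · exact leftOK_of_rule hgM hr (p := p) (q := q) (by simp [h])

theorem rightOK_gap (hgM : g.opm.Contained M) {r : ContextFreeRule α g.NT} (hr : r ∈ g.rules)
    {p q β : List (Symbol α g.NT)} {c : α} {x : List α} (hβ : g.GapMatch β x)
    (h : r.output = p ++ β ++ Symbol.terminal c :: q) : g.RightOK M β (some c) := by
  rcases hβ with ⟨rfl, -⟩ | ⟨r', -, rfl, -⟩
  · intro d β γ _ hd
    rcases hd.eq_or_head with hd | ⟨v, ⟨r, -, hv⟩, -⟩
    · simp at hd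
    · nomatch hv
  · exact rightOK_of_rule hgM hr (p := p) (q := q) (by simp [h])

/-- The terminals of a right-hand side are in the relations required of a simple chain, and its
nonterminals are in contexts that fit the gaps. -/
theorem skelTail_of_match (hgM : g.opm.Contained M) {r : ContextFreeRule α g.NT}
    (hr : r ∈ g.rules) {b : Option α} (hb : g.RightOK M r.output b)
    {p s : List (Symbol α g.NT)} {c : α} {x : List α} {l : List (α × List α)}
    (h : r.output = p ++ Symbol.terminal c :: s) (hm : g.Match s x l) :
    SkelTail M c (l.map Prod.fst) b ∧ ∀ q ∈ gaps (some c) x l b, g.Filled M q := by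
  induction l generalizing p s c x with
  | nil =>
    have hm' : g.GapMatch s x := hm
    refine ⟨hb c p s hm'.isOptNonterminal (by simp [h, Derives.refl]), ?_⟩
    simp only [gaps, List.forall_mem_singleton]
    refine hm'.filled (leftOK_gap hgM hr (q := []) hm' (by simpa using h)) ?_
    exact RightOK.of_append (s := p ++ [Symbol.terminal c]) (by simpa [h] using hb)
  | cons q l ih =>
    obtain ⟨β, s', rfl, hβ, hm⟩ := hm
    obtain ⟨h₁, h₂⟩ := ih (c := q.1) (p := p ++ Symbol.terminal c :: β) (by simp [h]) hm
    refine ⟨⟨hgM c q.1 (show PrecRel.eq ∈ g.opm _ _ from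
      ⟨r, hr, p, β, s', hβ.isOptNonterminal, by simp [h]⟩), h₁⟩, ?_⟩
    simp only [gaps, List.forall_mem_cons]
    exact ⟨hβ.filled (leftOK_gap hgM hr hβ h)
      (rightOK_gap hgM hr (p := p ++ [Symbol.terminal c]) hβ (by simpa using h)), h₂⟩

theorem skel_of_match (hgM : g.opm.Contained M) {r : ContextFreeRule α g.NT}
    (hr : r ∈ g.rules) {a b : Option α} (ha : g.LeftOK M a r.output)
    (hb : g.RightOK M r.output b) {x : List α} {l : List (α × List α)} (hl : l ≠ [])
    (hm : g.Match r.output x l) :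
    Skel M a (l.map Prod.fst) b ∧ ∀ q ∈ gaps a x l b, g.Filled M q := by
  obtain ⟨⟨c, y⟩, l, rfl⟩ := List.exists_cons_of_ne_nil hl
  obtain ⟨β, s', h, hβ, hm⟩ := hm
  obtain ⟨h₁, h₂⟩ := skelTail_of_match hgM hr hb h hm
  refine ⟨⟨ha c β s' hβ.isOptNonterminal (by simp [h, Derives.refl]), h₁⟩, ?_⟩
  simp only [gaps, List.forall_mem_cons]
  refine ⟨hβ.filled (LeftOK.of_append (t := Symbol.terminal c :: s') (by simpa [h] using ha))
    (rightOK_gap hgM hr (p := []) hβ (by simpa using h)), h₂⟩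

/-- Whatever a right-hand side derives has the structure prescribed by the matrix. -/
theorem gapIn_of_yields (hg : g.IsOperator) (hgM : g.opm.Contained M) {w : List α} :
    ∀ {r : ContextFreeRule α g.NT} {a b : Option α}, r ∈ g.rules → g.Yields r.output w →
      g.LeftOK M a r.output → g.RightOK M r.output b → (M.withDelim a b).Nonempty →
      GapIn M g.skeletons a w b := by
  induction hn : w.length using Nat.strong_induction_on generalizing w with
  | _ n ih =>
  intro r a b hr hw ha hb hab
  by_cases hne : w = []
  · rw [hne]
    exact .nil a b
  obtain ⟨r', hr', hd, x, l, hl, rfl, hm⟩ := exists_match_of_rule hg hr hw hne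
  obtain ⟨hs, hgaps⟩ := skel_of_match hgM hr' (ha.of_derives hd) (hb.of_derives hd) hl hm
  refine .chain hab ⟨r', hr', hm.letters_eq⟩ hs fun p hp => ?_
  rcases hgaps p hp with h | ⟨r'', hr'', h, ha', hb'⟩
  · rw [h]
    exact .nil _ _
  · exact ih _ (hn ▸ length_gap_lt hl p hp) rfl hr'' h ha' hb' (nonempty_of_mem_gaps hs p hp)

/-- The decomposition of a word along the rule found by `exists_match_of_rule` is the one followed
by the parser. -/
theorem exists_decomposition (hg : g.IsOperator) (hgM : g.opm.Contained M)
    {r : ContextFreeRule α g.NT} (hr : r ∈ g.rules) {w : List α} (h : g.Yields r.output w)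
    (hw : w ≠ []) :
    ∃ r' ∈ g.rules, g.Derives r.output r'.output ∧ ∃ x l, w = flat x l ∧
      g.Match r'.output x l ∧ HeadRuns M none x l [] := by
  obtain ⟨r', hr', hd, x, l, hl, hf, hm⟩ := exists_match_of_rule hg hr h hw
  obtain ⟨hs, hgaps⟩ := skel_of_match hgM hr' (leftOK_delim _) (rightOK_delim _) hl hm
  refine ⟨r', hr', hd, x, l, hf, hm, headRuns_delim (R := g.skeletons) hs fun p hp => ?_⟩
  rcases hgaps p hp with h | ⟨r'', hr'', h, ha', hb'⟩
  · rw [h]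
    exact .nil _ _
  · exact gapIn_of_yields hg hgM hr'' h ha' hb' (nonempty_of_mem_gaps hs p hp)

/-- `g.Sim x x'`: the word `x'` can replace `x` in the syntax trees of `g`. -/
def Sim (g : ContextFreeGrammar α) (x x' : List α) : Prop :=
  (x = [] → x' = []) ∧ ∀ r ∈ g.rules, g.Yields r.output x → g.Yields r.output x'

theorem GapMatch.of_sim {β : List (Symbol α g.NT)} {x x' : List α} (h : g.GapMatch β x)
    (hx : g.Sim x x') : g.GapMatch β x' := by
  rcases h with ⟨h₁, h₂⟩ | ⟨r, hr, h₁, h₂⟩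
  · exact .inl ⟨h₁, hx.1 h₂⟩
  · exact .inr ⟨r, hr, h₁, hx.2 r hr h₂⟩

theorem Match.of_sim {s : List (Symbol α g.NT)} {x x' : List α} {l l' : List (α × List α)}
    (h : g.Match s x l) (hx : g.Sim x x')
    (hl : List.Forall₂ (fun p p' => p.1 = p'.1 ∧ g.Sim p.2 p'.2) l l') : g.Match s x' l' := by
  induction hl generalizing s x x' with
  | nil => exact GapMatch.of_sim h hx
  | cons hp _ ih =>
    obtain ⟨β, s', hs, hβ, hm⟩ := h
    exact ⟨β, s', hp.1 ▸ hs, hβ.of_sim hx, ih hm hp.2⟩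

/-- In a chain body, gaps can be replaced by words that the same right-hand sides derive: since a
word has only one decomposition as a chain body, every syntax tree has these gaps as
constituents. -/
theorem yields_congr (hM : M.ConflictFree) (hg : g.IsOperator) (hgM : g.opm.Contained M)
    {x x' : List α} {l l' : List (α × List α)} (hd : HeadRuns M none x l [])
    (hx : g.Sim x x') (hl : List.Forall₂ (fun p p' => p.1 = p'.1 ∧ g.Sim p.2 p'.2) l l')
    {r : ContextFreeRule α g.NT} (hr : r ∈ g.rules) (h : g.Yields r.output (flat x l)) :
    g.Yields r.output (flat x' l') := by
  have hne : l ≠ [] := by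
    rintro rfl
    exact hd
  obtain ⟨r', hr', hd', y, k, hf, hm, hd''⟩ :=
    exists_decomposition hg hgM hr h (flat_ne_nil hne)
  obtain ⟨rfl, rfl⟩ := hd.unique hM hd'' hf
  exact .of_derives (hd'.trans (hm.of_sim hx hl).yields.derives)

/-! ### Bounds on the terminal sets of a grammar -/

/-- The terminals that can come first in what the string `s` derives, possibly after nonterminals,
if `T A` is a bound for those of the nonterminal `A`. -/
def firstTerminals {N : Type*} (T : N → Set α) : List (Symbol α N) → Set α
  | [] => ∅
  | .terminal c :: _ => {c}
  | .nonterminal A :: s => T A ∪ firstTerminals T s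

theorem firstTerminals_append_subset {N : Type*} (T : N → Set α) (s t : List (Symbol α N)) :
    firstTerminals T (s ++ t) ⊆ firstTerminals T s ∪ firstTerminals T t := by
  induction s with
  | nil => exact Set.subset_union_right
  | cons x s ih =>
    cases x with
    | terminal c => exact Set.subset_union_left
    | nonterminal A =>
      simp only [List.cons_append, firstTerminals, Set.union_assoc]
      exact Set.union_subset_union_right _ ih

theorem firstTerminals_append_mono {N : Type*} (T : N → Set α) (p : List (Symbol α N))
    {s t : List (Symbol α N)} (h : firstTerminals T s ⊆ firstTerminals T t) :
    firstTerminals T (p ++ s) ⊆ firstTerminals T (p ++ t) := by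
  induction p with
  | nil => exact h
  | cons x p ih =>
    cases x with
    | terminal c => exact subset_rfl
    | nonterminal A => exact Set.union_subset_union_right _ ih

/-- A family of sets that is closed under the rules bounds the left terminal sets. Rules that erase
nonterminals are no obstacle, since `firstTerminals` looks past any number of nonterminals. -/
theorem leftTerminals_subset {g : ContextFreeGrammar α} (T : g.NT → Set α)
    (h : ∀ r ∈ g.rules, firstTerminals T r.output ⊆ T r.input) (A : g.NT) :
    g.leftTerminals A ⊆ T A := by
  rintro c ⟨β, γ, hβ, hd⟩
  have key : ∀ {s t : List (Symbol α g.NT)}, g.Derives s t →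
      firstTerminals T t ⊆ firstTerminals T s := by
    intro s t hd
    induction hd with
    | refl => exact subset_rfl
    | tail _ hp ih =>
      obtain ⟨r, hr, hp⟩ := hp
      obtain ⟨p, q, rfl, rfl⟩ := hp.exists_parts
      refine subset_trans ?_ ih
      rw [List.append_assoc, List.append_assoc]
      refine firstTerminals_append_mono T p ?_
      exact (firstTerminals_append_subset T _ _).trans (Set.union_subset_union_left _ (h r hr))
  have hc : c ∈ firstTerminals T (β ++ [Symbol.terminal c] ++ γ) := by
    rcases hβ with rfl | ⟨B, rfl⟩ <;> simp [firstTerminals]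
  simpa [firstTerminals] using key hd hc

theorem rightTerminals_subset {g : ContextFreeGrammar α} (T : g.NT → Set α)
    (h : ∀ r ∈ g.rules, firstTerminals T r.output.reverse ⊆ T r.input) (A : g.NT) :
    g.rightTerminals A ⊆ T A := by
  rintro c ⟨γ, β, hβ, hd⟩
  refine leftTerminals_subset (g := g.reverse) T ?_ A ⟨β.reverse, γ.reverse, ?_, ?_⟩
  · intro r hr
    obtain ⟨r, hr', rfl⟩ := Finset.mem_map.1 (show r ∈ g.rules.map _ from hr)
    exact h r hr'
  · rcases hβ with rfl | ⟨B, rfl⟩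
    · exact .inl rfl
    · exact .inr ⟨B, rfl⟩
  · have he : (γ ++ [Symbol.terminal c] ++ β).reverse =
        β.reverse ++ [Symbol.terminal c] ++ γ.reverse := by simp
    have hd := hd.reverse
    rw [he] at hd
    exact hd

/-! ### The grammar of a recognizable set of structured words -/

section StructureGrammar

variable {Q : Type*} {k : ℕ} (e : Option (Option α × Option α × Q) ≃ Fin k) (val : List α → Q)

/-- The nonterminal for a gap `x` between `a` and `b`, absent if the gap is empty. The
nonterminals are triples `(a, b, q)`, for the words of value `q` between `a` and `b`, and a start
symbol; the equivalence `e` numbers them. -/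
def gapSymbol (a : Option α) : List α → Option α → List (Symbol α (Fin k))
  | [], _ => []
  | c :: x, b => [Symbol.nonterminal (e (some (a, b, val (c :: x))))]

/-- The right-hand side for the simple chain with letters those of `l` and with gaps filled by words
that have the neighbours and the values of the given gaps. -/
def rhs : Option α → List α → List (α × List α) → Option α → List (Symbol α (Fin k))
  | a, x, [], b => gapSymbol e val a x b
  | a, x, (c, y) :: l, b =>
    gapSymbol e val a x (some c) ++ Symbol.terminal c :: rhs (some c) y l b

/-- The rules `(a, b, q) → N₀ a₁ N₁ ⋯ aₙ Nₙ`, one for each combination of the neighbours and values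
of the gaps of a chain body between `a` and `b` of value `q`. -/
def chainRules (M : OPMatrix α) (R : Set (List α)) : Set (ContextFreeRule α (Fin k)) :=
  {r | ∃ a b x l, (M.withDelim a b).Nonempty ∧ l.map Prod.fst ∈ R ∧ Skel M a (l.map Prod.fst) b ∧
    (∀ p ∈ gaps a x l b, GapIn M R p.1 p.2.1 p.2.2) ∧
    r = ⟨e (some (a, b, val (flat x l))), rhs e val a x l b⟩}

/-- The rules for the start symbol. -/
def startRules (F : Set Q) : Set (ContextFreeRule α (Fin k)) :=
  {r | r.input = e none ∧ ((r.output = [] ∧ val [] ∈ F) ∨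
    ∃ q ∈ F, r.output = [Symbol.nonterminal (e (some (none, none, q)))])}

variable {e val}

theorem gapSymbol_eq (a : Option α) (x : List α) (b : Option α) :
    (x = [] ∧ gapSymbol e val a x b = []) ∨
      (x ≠ [] ∧ gapSymbol e val a x b = [Symbol.nonterminal (e (some (a, b, val x)))]) := by
  cases x with
  | nil => exact .inl ⟨rfl, rfl⟩
  | cons c x => exact .inr ⟨by simp, rfl⟩

theorem rhs_append (a : Option α) (x : List α) (l : List (α × List α)) (c : α) (y : List α)
    (l' : List (α × List α)) (b : Option α) :
    rhs e val a x (l ++ (c, y) :: l') b =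
      rhs e val a x l (some c) ++ Symbol.terminal c :: rhs e val (some c) y l' b := by
  induction l generalizing a x with
  | nil => rfl
  | cons q l ih => simp [rhs, ih]

theorem exists_of_rhs_eq {a : Option α} {x : List α} {l : List (α × List α)} {b : Option α}
    {γ δ : List (Symbol α (Fin k))} {c : α}
    (h : rhs e val a x l b = γ ++ Symbol.terminal c :: δ) :
    ∃ l₁ y l₂, l = l₁ ++ (c, y) :: l₂ ∧ γ = rhs e val a x l₁ (some c) ∧
      δ = rhs e val (some c) y l₂ b := by
  induction l generalizing a x γ with
  | nil =>
    have hc : Symbol.terminal c ∈ gapSymbol e val a x b := by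
      rw [show gapSymbol e val a x b = _ from h]
      simp
    rcases gapSymbol_eq (e := e) (val := val) a x b with ⟨-, h⟩ | ⟨-, h⟩ <;> simp [h] at hc
  | cons q l ih =>
    obtain ⟨d, y⟩ := q
    have step : ∀ γ', Symbol.terminal d :: rhs e val (some d) y l b =
        γ' ++ Symbol.terminal c :: δ → γ = gapSymbol e val a x (some d) ++ γ' →
        ∃ l₁ y' l₂, (d, y) :: l = l₁ ++ (c, y') :: l₂ ∧ γ = rhs e val a x l₁ (some c) ∧
          δ = rhs e val (some c) y' l₂ b := by
      intro γ' h hγ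
      obtain - | ⟨s, γ'⟩ := γ'
      · simp only [List.nil_append, List.cons.injEq, Symbol.terminal.injEq] at h
        obtain ⟨rfl, rfl⟩ := h
        exact ⟨[], y, l, rfl, by simpa [rhs] using hγ, rfl⟩
      · simp only [List.cons_append, List.cons.injEq] at h
        obtain ⟨rfl, h⟩ := h
        obtain ⟨l₁, y', l₂, rfl, rfl, rfl⟩ := ih h
        exact ⟨(d, y) :: l₁, y', l₂, rfl, hγ, rfl⟩
    rcases gapSymbol_eq (e := e) (val := val) a x (some d) with ⟨-, hs⟩ | ⟨-, hs⟩
    · exact step γ (by simpa [rhs, hs] using h) (by simp [hs])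
    · obtain - | ⟨s, γ'⟩ := γ
      · simp [rhs, hs] at h
      · simp only [rhs, hs, List.cons_append, List.nil_append, List.cons.injEq] at h
        exact step γ' h.2 (by simp [hs, h.1])

theorem rhs_isOperator (a : Option α) (x : List α) (l : List (α × List α)) (b : Option α)
    (β γ : List (Symbol α (Fin k))) (B C : Fin k) :
    rhs e val a x l b ≠ β ++ [Symbol.nonterminal B, Symbol.nonterminal C] ++ γ := by
  induction l generalizing a x β with
  | nil =>
    intro h
    have := congrArg List.length h
    rcases gapSymbol_eq (e := e) (val := val) a x b with ⟨-, hs⟩ | ⟨-, hs⟩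
    · simp [rhs, hs] at this
    · simp [rhs, hs] at this
      omega
  | cons q l ih =>
    obtain ⟨d, y⟩ := q
    intro h
    rcases gapSymbol_eq (e := e) (val := val) a x (some d) with ⟨-, hs⟩ | ⟨-, hs⟩
    · obtain - | ⟨s, β⟩ := β
      · simp [rhs, hs] at h
      · exact ih _ _ β (by simpa [rhs, hs] using (List.cons.inj (by simpa [rhs, hs] using h)).2)
    · obtain - | ⟨s, - | ⟨s', β⟩⟩ := β
      · simp [rhs, hs] at h
      · simp [rhs, hs] at h
      · simp only [rhs, hs, List.cons_append, List.nil_append, List.cons.injEq] at h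
        exact ih _ _ β (by simpa using h.2.2)

theorem length_rhs_le (a : Option α) (x : List α) (l : List (α × List α)) (b : Option α) :
    (rhs e val a x l b).length ≤ 2 * l.length + 1 := by
  induction l generalizing a x with
  | nil =>
    rcases gapSymbol_eq (e := e) (val := val) a x b with ⟨-, hs⟩ | ⟨-, hs⟩ <;> simp [rhs, hs]
  | cons q l ih =>
    have := ih (some q.1) q.2
    rcases gapSymbol_eq (e := e) (val := val) a x (some q.1) with ⟨-, hs⟩ | ⟨-, hs⟩ <;>
      simp [rhs, hs] <;> omega

theorem eq_of_rhs_eq_cons {a : Option α} {x : List α} {l : List (α × List α)} {b : Option α}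
    {D : Fin k} {γ : List (Symbol α (Fin k))}
    (h : rhs e val a x l b = Symbol.nonterminal D :: γ) : ∃ b' q, D = e (some (a, b', q)) := by
  have key : ∀ b' δ, gapSymbol e val a x b' ++ δ = Symbol.nonterminal D :: γ →
      (∀ s ∈ δ.head?, ∃ c, s = Symbol.terminal c) → ∃ b' q, D = e (some (a, b', q)) := by
    intro b' δ h hδ
    rcases gapSymbol_eq (e := e) (val := val) a x b' with ⟨-, hs⟩ | ⟨-, hs⟩
    · rw [hs, List.nil_append] at h
      obtain ⟨c, hc⟩ := hδ (Symbol.nonterminal D) (by simp [h])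
      exact nomatch hc
    · simp only [hs, List.cons_append, List.cons.injEq, Symbol.nonterminal.injEq] at h
      exact ⟨_, _, h.1.symm⟩
  cases l with
  | nil => exact key b [] (by simpa [rhs] using h) (by simp)
  | cons q l => exact key (some q.1) _ h (by simp)

theorem eq_of_rhs_eq_concat {a : Option α} {x : List α} {l : List (α × List α)} {b : Option α}
    {D : Fin k} {γ : List (Symbol α (Fin k))}
    (h : rhs e val a x l b = γ ++ [Symbol.nonterminal D]) : ∃ a' q, D = e (some (a', b, q)) := by
  obtain rfl | ⟨l, ⟨c, y⟩, rfl⟩ := l.eq_nil_or_concat'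
  · have := congrArg List.getLast? h
    rcases gapSymbol_eq (e := e) (val := val) a x b with ⟨-, hs⟩ | ⟨-, hs⟩
    · simp [rhs, hs] at this
    · simp only [rhs, hs, List.getLast?_singleton, List.getLast?_append, Option.some_or,
        Option.some.injEq, Symbol.nonterminal.injEq] at this
      exact ⟨_, _, this.symm⟩
  · rw [rhs_append] at h
    have := congrArg List.getLast? h
    rcases gapSymbol_eq (e := e) (val := val) (some c) y b with ⟨-, hs⟩ | ⟨-, hs⟩
    · simp [rhs, hs] at this
    · simp [rhs, hs] at this
      exact ⟨_, _, this.symm⟩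

variable {M : OPMatrix α} {R : Set (List α)} {F : Set Q}

theorem eq_of_skelTail {c d d' : α} {b : Option α} {l₁ l₂ : List α}
    (h : SkelTail M c (l₁ ++ d :: d' :: l₂) b) : PrecRel.eq ∈ M d d' := by
  induction l₁ generalizing c with
  | nil => exact h.2.1
  | cons _ l₁ ih => exact ih h.2

theorem eq_of_skel {a b : Option α} {d d' : α} {l₁ l₂ : List α}
    (h : Skel M a (l₁ ++ d :: d' :: l₂) b) : PrecRel.eq ∈ M d d' := by
  cases l₁ with
  | nil => exact h.2.1
  | cons _ l₁ => exact eq_of_skelTail h.2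

theorem gt_of_skelTail {c d : α} {b : Option α} {l : List α} (h : SkelTail M c (l ++ [d]) b) :
    PrecRel.gt ∈ M.withDelim (some d) b := by
  induction l generalizing c with
  | nil => exact h.2
  | cons _ l ih => exact ih h.2

theorem gt_of_skel {a b : Option α} {d : α} {l : List α} (h : Skel M a (l ++ [d]) b) :
    PrecRel.gt ∈ M.withDelim (some d) b := by
  cases l with
  | nil => exact h.2
  | cons _ l => exact gt_of_skelTail h.2

theorem terminal_notMem_startRules {r : ContextFreeRule α (Fin k)} (hr : r ∈ startRules e val F)
    (c : α) : Symbol.terminal c ∉ r.output := by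
  rcases hr with ⟨-, ⟨h, -⟩ | ⟨q, -, h⟩⟩ <;> simp [h]

theorem output_isOperator {r : ContextFreeRule α (Fin k)}
    (hr : r ∈ chainRules e val M R ∨ r ∈ startRules e val F) (β γ : List (Symbol α (Fin k)))
    (B C : Fin k) :
    r.output ≠ β ++ [Symbol.nonterminal B, Symbol.nonterminal C] ++ γ := by
  intro h
  rcases hr with ⟨a, b, x, l, -, -, -, -, rfl⟩ | ⟨-, ⟨h', -⟩ | ⟨q, -, h'⟩⟩
  · exact rhs_isOperator _ _ _ _ _ _ _ _ h
  · simp [h'] at h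
  · have := congrArg List.length (h'.symm.trans h)
    simp at this
    omega

theorem eq_of_output_eq {r : ContextFreeRule α (Fin k)}
    (hr : r ∈ chainRules e val M R ∨ r ∈ startRules e val F) {γ β δ : List (Symbol α (Fin k))}
    {c d : α} (hβ : IsOptNonterminal β)
    (h : r.output = γ ++ [Symbol.terminal c] ++ β ++ [Symbol.terminal d] ++ δ) :
    PrecRel.eq ∈ M c d := by
  rcases hr with ⟨a, b, x, l, -, -, hs, -, rfl⟩ | hr
  · obtain ⟨l₁, y, l₂, rfl, -, h⟩ := exists_of_rhs_eq (γ := γ)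
      (δ := β ++ Symbol.terminal d :: δ) (c := c) (by simpa using h)
    obtain ⟨l₃, y', l₄, rfl, h, -⟩ := exists_of_rhs_eq h.symm
    obtain - | ⟨p, l₃⟩ := l₃
    · exact eq_of_skel (l₁ := l₁.map Prod.fst) (l₂ := l₄.map Prod.fst) (by simpa using hs)
    · exact absurd (by simp [h, rhs]) (terminal_notMem_of_isOptNonterminal hβ p.1)
  · exact absurd (by simp [h]) (terminal_notMem_startRules hr c)

theorem exists_of_output_eq_left {r : ContextFreeRule α (Fin k)}
    (hr : r ∈ chainRules e val M R ∨ r ∈ startRules e val F) {γ δ : List (Symbol α (Fin k))}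
    {c : α} {D : Fin k}
    (h : r.output = γ ++ [Symbol.terminal c, Symbol.nonterminal D] ++ δ) :
    ∃ b q, D = e (some (some c, b, q)) := by
  rcases hr with ⟨a, b, x, l, -, -, -, -, rfl⟩ | hr
  · obtain ⟨l₁, y, l₂, -, -, h⟩ := exists_of_rhs_eq (γ := γ) (δ := Symbol.nonterminal D :: δ)
      (by simpa using h)
    exact eq_of_rhs_eq_cons h.symm
  · exact absurd (by simp [h]) (terminal_notMem_startRules hr c)

theorem exists_of_output_eq_right {r : ContextFreeRule α (Fin k)}
    (hr : r ∈ chainRules e val M R ∨ r ∈ startRules e val F) {γ δ : List (Symbol α (Fin k))}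
    {c : α} {D : Fin k}
    (h : r.output = γ ++ [Symbol.nonterminal D, Symbol.terminal c] ++ δ) :
    ∃ a q, D = e (some (a, some c, q)) := by
  rcases hr with ⟨a, b, x, l, -, -, -, -, rfl⟩ | hr
  · obtain ⟨l₁, y, l₂, -, h, -⟩ := exists_of_rhs_eq (e := e) (val := val) (a := a) (b := b)
      (x := x) (l := l) (γ := γ ++ [Symbol.nonterminal D]) (δ := δ) (c := c) (by simpa using h)
    exact eq_of_rhs_eq_concat h.symm
  · exact absurd (by simp [h]) (terminal_notMem_startRules hr c)

theorem firstTerminals_rhs {T : Fin k → Set α} {a b : Option α} {x : List α}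
    {l : List (α × List α)} {U : Set α} (hl : l ≠ [])
    (hU : ∀ c ∈ (l.map Prod.fst).head?, c ∈ U) (hT : ∀ b q, T (e (some (a, b, q))) ⊆ U) :
    firstTerminals T (rhs e val a x l b) ⊆ U := by
  obtain ⟨⟨c, y⟩, l, rfl⟩ := List.exists_cons_of_ne_nil hl
  have hc : c ∈ U := hU c (by simp)
  rcases gapSymbol_eq (e := e) (val := val) a x (some c) with ⟨-, hs⟩ | ⟨-, hs⟩
  · simpa [rhs, hs, firstTerminals] using hc
  · simpa [rhs, hs, firstTerminals, Set.insert_subset_iff] using ⟨hc, hT _ _⟩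

theorem firstTerminals_reverse_rhs {T : Fin k → Set α} {a b : Option α} {x : List α}
    {l : List (α × List α)} {U : Set α} (hl : l ≠ [])
    (hU : ∀ c ∈ (l.map Prod.fst).getLast?, c ∈ U) (hT : ∀ a q, T (e (some (a, b, q))) ⊆ U) :
    firstTerminals T (rhs e val a x l b).reverse ⊆ U := by
  obtain rfl | ⟨l, ⟨c, y⟩, rfl⟩ := l.eq_nil_or_concat'
  · exact absurd rfl hl
  have hc : c ∈ U := hU c (by simp)
  rw [rhs_append]
  rcases gapSymbol_eq (e := e) (val := val) (some c) y b with ⟨-, hs⟩ | ⟨-, hs⟩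
  · simpa [rhs, hs, firstTerminals] using hc
  · simpa [rhs, hs, firstTerminals, Set.insert_subset_iff] using ⟨hc, hT _ _⟩

variable (e val M R F)

theorem finite_rules [Finite α] (hR : R.Finite) :
    (chainRules e val M R ∪ startRules e val F).Finite := by
  obtain ⟨n, hn⟩ := (hR.image List.length).bddAbove
  have : Finite (Symbol α (Fin k)) := by
    refine Finite.of_injective (β := α ⊕ Fin k) (fun
      | .terminal a => .inl a
      | .nonterminal A => .inr A) ?_
    rintro (a | A) (b | B) h <;> simp_all
  have hfin := (Set.finite_univ (α := Fin k)).prod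
    (List.finite_length_le (Symbol α (Fin k)) (2 * n + 1))
  refine (hfin.image fun p => (⟨p.1, p.2⟩ : ContextFreeRule α (Fin k))).subset ?_
  intro r hr
  refine ⟨(r.input, r.output), ⟨trivial, ?_⟩, rfl⟩
  change r.output.length ≤ _
  rcases hr with ⟨a, b, x, l, -, hl, -, -, rfl⟩ | ⟨-, ⟨h, -⟩ | ⟨q, -, h⟩⟩
  · have h₁ := length_rhs_le (e := e) (val := val) a x l b
    have h₂ : l.length ≤ n := hn ⟨_, hl, by simp⟩
    change (rhs e val a x l b).length ≤ _
    omega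
  · simp [h]
  · simp [h]

/-- The grammar of the words `w` such that `# w #` has the structure given by `M`, with simple
chains restricted to `R`, and whose value is in `F`. -/
noncomputable def structureGrammar [Finite α] (hR : R.Finite) : ContextFreeGrammar α where
  NT := Fin k
  initial := e none
  rules := (finite_rules e val M R F hR).toFinset

variable {e val M R F} [Finite α] {hR : R.Finite}

theorem mem_structureGrammar_rules {r : ContextFreeRule α (Fin k)} :
    r ∈ (structureGrammar e val M R F hR).rules ↔
      r ∈ chainRules e val M R ∨ r ∈ startRules e val F :=
  (finite_rules e val M R F hR).mem_toFinset

theorem structureGrammar_isOperator : (structureGrammar e val M R F hR).IsOperator :=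
  fun _ hr => output_isOperator (mem_structureGrammar_rules.1 hr)

theorem leftTerminals_structureGrammar {a b : Option α} {q : Q} {c : α}
    (h : c ∈ (structureGrammar e val M R F hR).leftTerminals (e (some (a, b, q)))) :
    PrecRel.lt ∈ M.withDelim a (some c) := by
  have := leftTerminals_subset (g := structureGrammar e val M R F hR)
    (fun A => {c | ∀ a b q, e.symm A = some (a, b, q) → PrecRel.lt ∈ M.withDelim a (some c)})
    ?_ _ h
  · exact this a b q (by simp)
  intro r hr
  rcases mem_structureGrammar_rules.1 hr with ⟨a, b, x, l, -, -, hs, -, rfl⟩ | ⟨h, -⟩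
  · refine firstTerminals_rhs hs.ne_nil ?_ ?_
    · obtain ⟨p, l, rfl⟩ := List.exists_cons_of_ne_nil hs.ne_nil
      intro c hc a' b' q' h
      simp at hc h
      obtain ⟨rfl, rfl, rfl⟩ := h
      subst hc
      exact hs.1
    · intro b' q' c hc a'' b'' q'' h
      simp at h
      obtain ⟨rfl, rfl, rfl⟩ := h
      exact hc a b' q' (by simp)
  · intro c _ a b q h'
    simp [h] at h'

theorem rightTerminals_structureGrammar {a b : Option α} {q : Q} {c : α}
    (h : c ∈ (structureGrammar e val M R F hR).rightTerminals (e (some (a, b, q)))) :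
    PrecRel.gt ∈ M.withDelim (some c) b := by
  have := rightTerminals_subset (g := structureGrammar e val M R F hR)
    (fun A => {c | ∀ a b q, e.symm A = some (a, b, q) → PrecRel.gt ∈ M.withDelim (some c) b})
    ?_ _ h
  · exact this a b q (by simp)
  intro r hr
  rcases mem_structureGrammar_rules.1 hr with ⟨a, b, x, l, -, -, hs, -, rfl⟩ | ⟨h, -⟩
  · refine firstTerminals_reverse_rhs hs.ne_nil ?_ ?_
    · obtain rfl | ⟨l, p, rfl⟩ := l.eq_nil_or_concat'
      · exact hs.elim
      intro c hc a' b' q' h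
      simp at hc h
      obtain ⟨rfl, rfl, rfl⟩ := h
      subst hc
      exact gt_of_skel (l := l.map Prod.fst) (by simpa using hs)
    · intro a' q' c hc a'' b'' q'' h
      simp at h
      obtain ⟨rfl, rfl, rfl⟩ := h
      exact hc a' b q' (by simp)
  · intro c _ a b q h'
    simp [h] at h'

theorem structureGrammar_opm_contained : (structureGrammar e val M R F hR).opm.Contained M := by
  rintro c d (_ | _ | _) h
  · obtain ⟨r, hr, γ, δ, D, h, hd⟩ := h
    obtain ⟨b, q, rfl⟩ := exists_of_output_eq_left (mem_structureGrammar_rules.1 hr) h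
    exact leftTerminals_structureGrammar hd
  · obtain ⟨r, hr, γ, β, δ, hβ, h⟩ := h
    exact eq_of_output_eq (mem_structureGrammar_rules.1 hr) hβ h
  · obtain ⟨r, hr, γ, δ, D, h, hd⟩ := h
    obtain ⟨a, q, rfl⟩ := exists_of_output_eq_right (mem_structureGrammar_rules.1 hr) h
    exact rightTerminals_structureGrammar hd

end StructureGrammar

/-! ### The language of the structure grammar -/

section StructureGrammar

variable {Q : Type*} {k : ℕ} {e : Option (Option α × Option α × Q) ≃ Fin k} {val : List α → Q}
  {M : OPMatrix α} {R : Set (List α)} {F : Set Q}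

/-- The words `x` and `x'` are both empty or both nonempty, and have the same value. Emptiness
matters because `gapSymbol` has no nonterminal for an empty gap. -/
def SameValue (val : List α → Q) (x x' : List α) : Prop :=
  (x = [] ↔ x' = []) ∧ val x = val x'

/-- The value of a chain body is determined by its letters and the values of its gaps. -/
def Compositional (val : List α → Q) (M : OPMatrix α) : Prop :=
  ∀ ⦃x l x' l'⦄, HeadRuns M none x l [] → HeadRuns M none x' l' [] → SameValue val x x' →
    List.Forall₂ (fun p p' => p.1 = p'.1 ∧ SameValue val p.2 p'.2) l l' →
    val (flat x l) = val (flat x' l')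

theorem map_fst_eq {S : List α → List α → Prop} {l l' : List (α × List α)}
    (h : List.Forall₂ (fun p p' => p.1 = p'.1 ∧ S p.2 p'.2) l l') :
    l.map Prod.fst = l'.map Prod.fst := by
  induction h with
  | nil => rfl
  | cons h _ ih => simp [h.1, ih]

variable [Finite α] {hR : R.Finite}

theorem yields_rhs {a b : Option α} {x : List α} {l : List (α × List α)}
    (h : ∀ p ∈ gaps a x l b, p.2.1 ≠ [] → (structureGrammar e val M R F hR).Yields
      [Symbol.nonterminal (e (some (p.1, p.2.2, val p.2.1)))] p.2.1) :
    (structureGrammar e val M R F hR).Yields (rhs e val a x l b) (flat x l) := by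
  have key : ∀ b', (x ≠ [] → (structureGrammar e val M R F hR).Yields
      [Symbol.nonterminal (e (some (a, b', val x)))] x) →
      (structureGrammar e val M R F hR).Yields (gapSymbol e val a x b') x := by
    intro b' h
    cases x with
    | nil => exact .nil
    | cons c x => exact h (by simp)
  induction l generalizing a x with
  | nil => exact key b (by simpa [gaps] using h)
  | cons q l ih =>
    simp only [gaps, List.forall_mem_cons] at h
    refine (key _ h.1).append (.terminal _ (ih h.2 ?_))
    intro b' h'
    generalize q.2 = y at h'
    cases y with
    | nil => exact .nil
    | cons c x => exact h' (by simp)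

theorem yields_of_gapIn {a b : Option α} {x : List α} (h : GapIn M R a x b) (hx : x ≠ []) :
    (structureGrammar e val M R F hR).Yields
      [Symbol.nonterminal (e (some (a, b, val x)))] x := by
  induction h with
  | nil => exact absurd rfl hx
  | @chain a b x l hn hl hs hg ih =>
    exact yields_nonterminal_iff.2 ⟨_, mem_structureGrammar_rules.2
      (.inl ⟨a, b, x, l, hn, hl, hs, hg, rfl⟩), rfl, yields_rhs ih⟩

/-- A word derived from the right-hand side for `(x', l')` has a decomposition that matches it in
letters and values, if the nonterminals are correct for words of length less than `n`. -/
theorem exists_flat_of_yields_rhs {n : ℕ}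
    (hn : ∀ a b q w, w.length < n → (structureGrammar e val M R F hR).Yields
      [Symbol.nonterminal (e (some (a, b, q)))] w → w ≠ [] ∧ GapIn M R a w b ∧ val w = q)
    {a b : Option α} {x' : List α} {l' : List (α × List α)} {w : List α}
    (hw : w.length < n ∨ (l' ≠ [] ∧ w.length ≤ n))
    (h : (structureGrammar e val M R F hR).Yields (rhs e val a x' l' b) w) :
    ∃ x l, w = flat x l ∧ SameValue val x x' ∧
      List.Forall₂ (fun p p' => p.1 = p'.1 ∧ SameValue val p.2 p'.2) l l' ∧
      ∀ p ∈ gaps a x l b, GapIn M R p.1 p.2.1 p.2.2 := by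
  have key : ∀ {a b x' w}, w.length < n →
      (structureGrammar e val M R F hR).Yields (gapSymbol e val a x' b) w →
      SameValue val w x' ∧ GapIn M R a w b := by
    intro a b x' w hw h
    cases x' with
    | nil =>
      rw [Yields.eq_nil h]
      exact ⟨⟨Iff.rfl, rfl⟩, .nil _ _⟩
    | cons c x' =>
      obtain ⟨h₁, h₂, h₃⟩ := hn _ _ _ _ hw h
      exact ⟨⟨by simp [h₁], h₃⟩, h₂⟩
  induction l' generalizing a x' w with
  | nil =>
    obtain ⟨h₁, h₂⟩ := key (by simpa using hw) h
    exact ⟨w, [], rfl, h₁, .nil, by simpa [gaps] using h₂⟩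
  | cons q l' ih =>
    obtain ⟨w₁, w₂, rfl, h₁, h₂⟩ := h.exists_of_append
    obtain ⟨w₂, rfl, h₃⟩ := Yields.exists_of_terminal h₂
    simp only [List.length_append, List.length_cons] at hw
    obtain ⟨hv, hg⟩ := key (by omega) h₁
    obtain ⟨x, l, rfl, hv', hl, hgl⟩ := ih (.inl (by omega)) h₃
    refine ⟨w₁, (q.1, x) :: l, rfl, hv, .cons ⟨rfl, hv'⟩ hl, ?_⟩
    simp only [gaps, List.forall_mem_cons]
    exact ⟨hg, hgl⟩

/-- The nonterminal `(a, b, q)` derives only chain bodies between `a` and `b` of value `q`. -/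
theorem gapIn_of_yields_structureGrammar (hval : Compositional val M) (a b : Option α) (q : Q)
    (w : List α) (h : (structureGrammar e val M R F hR).Yields
      [Symbol.nonterminal (e (some (a, b, q)))] w) :
    w ≠ [] ∧ GapIn M R a w b ∧ val w = q := by
  induction hn : w.length using Nat.strong_induction_on generalizing w a b q with
  | _ n ih =>
  obtain ⟨r, hr, he, hy⟩ := yields_nonterminal_iff.1 h
  rcases mem_structureGrammar_rules.1 hr with ⟨a', b', x', l', hne, hl, hs, hg, rfl⟩ | ⟨h', -⟩
  · have he' := e.injective he
    simp only [Option.some.injEq, Prod.mk.injEq] at he'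
    obtain ⟨rfl, rfl, rfl⟩ := he'
    obtain ⟨x, l, rfl, hv, hll, hgl⟩ := exists_flat_of_yields_rhs
      (fun a b q w hw hy => ih _ hw a b q w hy rfl) (.inr ⟨hs.ne_nil, hn.le⟩) hy
    have hmap := map_fst_eq hll
    rw [← hmap] at hl hs
    refine ⟨flat_ne_nil hs.ne_nil, .chain hne hl hs hgl, ?_⟩
    exact hval (headRuns_delim hs hgl) (headRuns_delim (hmap ▸ hs) hg) hv hll
  · exact absurd (e.injective (he.symm.trans h')) (by simp)

theorem mem_language_structureGrammar (hval : Compositional val M) {w : List α} :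
    w ∈ (structureGrammar e val M R F hR).language ↔ GapIn M R none w none ∧ val w ∈ F := by
  rw [mem_language_iff_yields]
  constructor
  · rintro ⟨r, hr, he, h⟩
    rcases mem_structureGrammar_rules.1 hr with
      ⟨a', b', x', l', -, -, -, -, rfl⟩ | ⟨-, ⟨h', hF⟩ | ⟨q, hq, h'⟩⟩
    · exact absurd (e.injective he) (by simp)
    · rw [h'] at h
      rw [Yields.eq_nil h]
      exact ⟨.nil _ _, hF⟩
    · rw [h'] at h
      obtain ⟨-, h₁, rfl⟩ := gapIn_of_yields_structureGrammar hval _ _ _ _ h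
      exact ⟨h₁, hq⟩
  · rintro ⟨h, hF⟩
    by_cases hw : w = []
    · subst hw
      exact ⟨⟨e none, []⟩, mem_structureGrammar_rules.2 (.inr ⟨rfl, .inl ⟨rfl, hF⟩⟩), rfl, .nil⟩
    · exact ⟨⟨e none, [Symbol.nonterminal (e (some (none, none, val w)))]⟩,
        mem_structureGrammar_rules.2 (.inr ⟨rfl, .inr ⟨_, hF, rfl⟩⟩), rfl, yields_of_gapIn h hw⟩

end StructureGrammar

end ContextFreeGrammar

section Family

open ContextFreeGrammar OPMatrix

variable {α : Type*} {M : OPMatrix α}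

/-! ### Closure under the Boolean operations -/

theorem OPMatrix.ConflictFree.of_contained (hM : M.ConflictFree) {M' : OPMatrix α}
    (h : M'.Contained M) : M'.ConflictFree :=
  fun a b => (hM a b).anti (h a b)

/-- The words with a structure according to `M`, with finitely many possible simple chains, whose
value lies in a given set form a language of the family, if the values are compositional. -/
theorem mem_oplFamily_of_compositional [Finite α] {Q : Type*} [Finite Q] (hM : M.ConflictFree)
    {R : Set (List α)} (hR : R.Finite) {val : List α → Q} (hval : Compositional val M)
    (F : Set Q) {L : Language α} (hL : ∀ w, w ∈ L ↔ GapIn M R none w none ∧ val w ∈ F) :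
    L ∈ oplFamily M := by
  obtain ⟨k, ⟨e⟩⟩ := Finite.exists_equiv_fin (Option (Option α × Option α × Q))
  have hc := structureGrammar_opm_contained (e := e) (val := val) (M := M) (F := F) (hR := hR)
  refine ⟨structureGrammar e val M R F hR,
    ⟨structureGrammar_isOperator, hM.of_contained hc⟩, hc, ?_⟩
  ext w
  rw [mem_language_structureGrammar hval, hL]

namespace ContextFreeGrammar

/-- The rules of `g` whose right-hand side derives the word `w`. -/
def ruleSet (g : ContextFreeGrammar α) (w : List α) : Set {r // r ∈ g.rules} :=
  {r | g.Yields r.1.output w}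

theorem sim_of_sameValue {g : ContextFreeGrammar α} {x x' : List α}
    (h : SameValue g.ruleSet x x') : g.Sim x x' :=
  ⟨h.1.1, fun r hr hx => (Set.ext_iff.1 h.2 ⟨r, hr⟩).1 hx⟩

theorem SameValue.symm {Q : Type*} {val : List α → Q} {x x' : List α} (h : SameValue val x x') :
    SameValue val x' x :=
  ⟨h.1.symm, h.2.symm⟩

theorem compositional_ruleSet (hM : M.ConflictFree) {g : ContextFreeGrammar α}
    (hg : g.IsOperator) (hgM : g.opm.Contained M) : Compositional g.ruleSet M := by
  intro x l x' l' hd hd' hx hl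
  ext ⟨r, hr⟩
  constructor
  · exact yields_congr hM hg hgM hd (sim_of_sameValue hx)
      (hl.imp fun _ _ h => ⟨h.1, sim_of_sameValue h.2⟩) hr
  · exact yields_congr hM hg hgM hd' (sim_of_sameValue hx.symm)
      (hl.flip.imp fun _ _ h => ⟨h.1.symm, sim_of_sameValue h.2.symm⟩) hr

theorem Compositional.prod {Q Q' : Type*} {val : List α → Q} {val' : List α → Q'}
    (h : Compositional val M) (h' : Compositional val' M) :
    Compositional (fun w => (val w, val' w)) M := by
  intro x l x' l' hd hd' hx hl
  have hfst : ∀ {y y'}, SameValue (fun w => (val w, val' w)) y y' → SameValue val y y' :=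
    fun h => ⟨h.1, congrArg Prod.fst h.2⟩
  have hsnd : ∀ {y y'}, SameValue (fun w => (val w, val' w)) y y' → SameValue val' y y' :=
    fun h => ⟨h.1, congrArg Prod.snd h.2⟩
  exact Prod.ext (h hd hd' (hfst hx) (hl.imp fun _ _ h => ⟨h.1, hfst h.2⟩))
    (h' hd hd' (hsnd hx) (hl.imp fun _ _ h => ⟨h.1, hsnd h.2⟩))

theorem gapIn_of_mem_language {g : ContextFreeGrammar α} (hg : g.IsOperator)
    (hgM : g.opm.Contained M) {w : List α} (h : w ∈ g.language) :
    GapIn M g.skeletons none w none := by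
  obtain ⟨r, hr, -, h⟩ := mem_language_iff_yields.1 h
  exact gapIn_of_yields hg hgM hr h (leftOK_delim _) (rightOK_delim _) ⟨_, rfl⟩

end ContextFreeGrammar

/-- Closure of `oplFamily M` under the Boolean operations `φ` with `φ False False = False`: the
grammar keeps track of the rules of both grammars that derive the current constituent. -/
theorem mem_oplFamily_of_boolean [Finite α] (hM : M.ConflictFree) {L₁ L₂ L : Language α}
    (h₁ : L₁ ∈ oplFamily M) (h₂ : L₂ ∈ oplFamily M) (φ : Prop → Prop → Prop)
    (hφ : ∀ p q, φ p q → p ∨ q) (hL : ∀ w, w ∈ L ↔ φ (w ∈ L₁) (w ∈ L₂)) :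
    L ∈ oplFamily M := by
  obtain ⟨g₁, hg₁, hgM₁, rfl⟩ := h₁
  obtain ⟨g₂, hg₂, hgM₂, rfl⟩ := h₂
  refine mem_oplFamily_of_compositional hM (g₁.finite_skeletons.union g₂.finite_skeletons)
    ((compositional_ruleSet hM hg₁.1 hgM₁).prod (compositional_ruleSet hM hg₂.1 hgM₂))
    {q | φ (∃ r ∈ q.1, r.1.input = g₁.initial) (∃ r ∈ q.2, r.1.input = g₂.initial)}
    fun w => ?_
  have key : ∀ g : ContextFreeGrammar α,
      w ∈ g.language ↔ ∃ r ∈ g.ruleSet w, r.1.input = g.initial := by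
    intro g
    rw [mem_language_iff_yields]
    constructor
    · rintro ⟨r, hr, h, h'⟩
      exact ⟨⟨r, hr⟩, h', h⟩
    · rintro ⟨⟨r, hr⟩, h', h⟩
      exact ⟨r, hr, h, h'⟩
  rw [hL, Set.mem_ofPred_eq, ← key, ← key]
  refine ⟨fun h => ⟨?_, h⟩, fun h => h.2⟩
  rcases hφ _ _ h with h | h
  · exact (gapIn_of_mem_language hg₁.1 hgM₁ h).mono fun _ _ _ _ h => .inl h
  · exact (gapIn_of_mem_language hg₂.1 hgM₂ h).mono fun _ _ _ _ h => .inr h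

theorem bot_mem_oplFamily [Finite α] (hM : M.ConflictFree) : (⊥ : Language α) ∈ oplFamily M :=
  mem_oplFamily_of_compositional hM (R := ∅) Set.finite_empty (val := fun _ => ())
    (fun _ _ _ _ _ _ _ _ => rfl) ∅ fun _ => ⟨fun h => h.elim, fun h => h.2.elim⟩

/-! ### The largest language -/

theorem isChain_of_skelTail {c : α} {l : List α} {b : Option α} (h : SkelTail M c l b) :
    (c :: l).IsChain fun c d => PrecRel.eq ∈ M c d := by
  induction l generalizing c with
  | nil => exact .singleton c
  | cons d l ih => exact .cons_cons h.1 (ih h.2)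

/-- If `≐` has no cycles, the letters of a simple chain are distinct, so there are finitely many
simple chains. -/
theorem OPMatrix.EqAcyclic.finite_skel [Finite α] (hM : M.EqAcyclic) :
    {ls | ∃ a b, Skel M a ls b}.Finite := by
  have := Fintype.ofFinite α
  refine (List.finite_length_le α (Fintype.card α)).subset ?_
  rintro ls ⟨a, b, h⟩
  obtain - | ⟨c, l⟩ := ls
  · exact h.elim
  refine List.Nodup.length_le_card ?_
  have h₁ : (c :: l).IsChain (Relation.TransGen fun c d => PrecRel.eq ∈ M c d) :=
    (isChain_of_skelTail h.2).imp fun _ _ h => .single h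
  refine h₁.pairwise.imp ?_
  rintro d _ h rfl
  exact hM d h

/-- The words that have a structure according to `M`. -/
def structuredWords (M : OPMatrix α) : Language α :=
  {w | GapIn M Set.univ none w none}

theorem structuredWords_mem_oplFamily [Finite α] (hM : M.ConflictFree) (hE : M.EqAcyclic) :
    structuredWords M ∈ oplFamily M :=
  mem_oplFamily_of_compositional hM hE.finite_skel (val := fun _ => ())
    (fun _ _ _ _ _ _ _ _ => rfl) Set.univ fun w => by
      refine ⟨fun h => ⟨GapIn.mono ?_ h, trivial⟩, fun h => h.1.mono fun _ _ _ _ _ => trivial⟩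
      exact fun a _ b h _ => ⟨a, b, h⟩

theorem le_structuredWords {L : Language α} (hL : L ∈ oplFamily M) : L ≤ structuredWords M := by
  obtain ⟨g, hg, hgM, rfl⟩ := hL
  exact fun w hw => (gapIn_of_mem_language hg.1 hgM hw).mono fun _ _ _ _ _ => trivial

theorem structuredWords_eq_top (hM : M.Complete) : structuredWords M = ⊤ :=
  top_unique fun w _ => (hM.chainGap w).gapIn

theorem opm_eq_of_language_eq_top {g : ContextFreeGrammar α} (hM : M.ConflictFree)
    (hg : g.IsOperator) (hgM : g.opm.Contained M) (hL : g.language = ⊤) : g.opm = M := by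
  funext a b
  refine (hgM a b).antisymm fun ρ hρ => ?_
  have hw : [a, b] ∈ g.language := by
    rw [hL]
    trivial
  -- The structure of `a b` with respect to the matrix of `g` itself shows that the cell `(a, b)`
  -- of this matrix is not empty.
  have hr := (gapIn_of_mem_language (M := g.opm) hg (fun _ _ => subset_rfl) hw).runs
    (z := []) rfl
  obtain ⟨σ, hσ⟩ : (g.opm a b).Nonempty := by
    rcases hr.eq_or_push with h | ⟨c, w, z, h, -, hp, -⟩
    · simp at h
    · simp only [List.append_nil, List.cons.injEq] at h
      obtain ⟨rfl, rfl⟩ := h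
      cases hp with
      | pop h => exact ⟨_, h⟩
      | shift h => exact ⟨_, h⟩
      | push h => exact ⟨_, h⟩
  rwa [hM a b hρ (hgM a b hσ)]

end Family

namespace ContextFreeGrammar

variable {α : Type*} {g : ContextFreeGrammar α} {M : OPMatrix α} {R : Set (List α)}

open OPMatrix

/-! ### Constituents are chain bodies -/

/-- The condition on neighbouring symbols that holds in all strings derived from the axiom. -/
def AdjOK (g : ContextFreeGrammar α) (M : OPMatrix α) :
    Symbol α g.NT → Symbol α g.NT → Prop
  | .terminal _, .terminal _ => True
  | .terminal c, .nonterminal A => g.LeftOK M (some c) [Symbol.nonterminal A]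
  | .nonterminal A, .terminal c => g.RightOK M [Symbol.nonterminal A] (some c)
  | .nonterminal _, .nonterminal _ => False

theorem isChain_adjOK_output (hg : g.IsOperator) (hgM : g.opm.Contained M)
    {r : ContextFreeRule α g.NT} (hr : r ∈ g.rules) : r.output.IsChain (g.AdjOK M) := by
  rw [List.isChain_iff_forall_rel_of_append_cons_cons]
  rintro (c | A) (d | B) p q h
  · trivial
  · exact leftOK_of_rule hgM hr (p := p) (q := q) (by simpa using h)
  · exact rightOK_of_rule hgM hr (p := p) (q := q) (by simpa using h)
  · exact absurd (by simpa using h) (hg r hr p q A B)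

theorem AdjOK.head_output {r : ContextFreeRule α g.NT} (hr : r ∈ g.rules) {s : Symbol α g.NT}
    (h : g.AdjOK M s (.nonterminal r.input)) : ∀ t ∈ r.output.head?, g.AdjOK M s t := by
  rintro (c | A) ht <;> rcases s with d | B
  · trivial
  · exact h.elim
  · obtain ⟨q, hq⟩ : ∃ q, r.output = [Symbol.nonterminal A] ++ q := by
      generalize r.output = o at ht
      cases o with
      | nil => simp at ht
      | cons t o => exact ⟨o, by simpa using ht⟩
    have := LeftOK.of_derives h (derives_rule hr)
    rw [hq] at this
    exact this.of_append
  · exact h.elim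

theorem AdjOK.getLast_output {r : ContextFreeRule α g.NT} (hr : r ∈ g.rules) {s : Symbol α g.NT}
    (h : g.AdjOK M (.nonterminal r.input) s) : ∀ t ∈ r.output.getLast?, g.AdjOK M t s := by
  rintro (c | A) ht <;> rcases s with d | B
  · trivial
  · exact h.elim
  · obtain ⟨p, hp⟩ := List.getLast?_eq_some_iff.1 ht
    have := RightOK.of_derives h (derives_rule hr)
    rw [hp] at this
    exact this.of_append
  · exact h.elim

/-- Derivations preserve the condition on neighbouring symbols. A nonterminal may be erased because
both its neighbours are terminals. -/
theorem isChain_adjOK (hg : g.IsOperator) (hgM : g.opm.Contained M)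
    {s t : List (Symbol α g.NT)} (hd : g.Derives s t) (hs : s.IsChain (g.AdjOK M)) :
    t.IsChain (g.AdjOK M) := by
  induction hd with
  | refl => exact hs
  | tail _ hp ih =>
    obtain ⟨r, hr, hp⟩ := hp
    obtain ⟨p, q, rfl, rfl⟩ := hp.exists_parts
    rw [List.append_assoc, List.isChain_append, List.isChain_append] at ih ⊢
    obtain ⟨hp, ⟨-, hq, hBq⟩, hpB⟩ := ih
    simp only [List.getLast?_singleton, Option.mem_some_iff, forall_eq', List.singleton_append,
      List.head?_cons] at hBq hpB
    refine ⟨hp, ⟨isChain_adjOK_output hg hgM hr, hq, fun x hx y hy =>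
      AdjOK.getLast_output hr (hBq y hy) x hx⟩, fun x hx y hy => ?_⟩
    by_cases ho : r.output = []
    · rw [ho, List.nil_append] at hy
      have h₁ := hpB x hx
      have h₂ := hBq y hy
      rcases x with c | A <;> rcases y with d | B
      · trivial
      · exact h₂.elim
      · exact h₁.elim
      · exact h₁.elim
    · refine AdjOK.head_output hr (hpB x hx) y ?_
      rwa [List.head?_append_of_ne_nil _ ho] at hy

theorem chain_of_isConstituent (hM : M.Complete) (hg : g.IsOperator) (hgM : g.opm.Contained M)
    {u x v : List α} (hx : x ≠ []) (h : g.IsConstituent u x v) :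
    M.Chain u.getLast? x v.head? := by
  obtain ⟨A, hA, hAx⟩ := h
  obtain ⟨r, hr, rfl, hy⟩ := yields_nonterminal_iff.1 (Yields.of_derives hAx)
  have hc := isChain_adjOK hg hgM hA (List.isChain_singleton _)
  rw [List.append_assoc, List.isChain_append, List.isChain_append] at hc
  obtain ⟨-, ⟨-, -, hB⟩, hA⟩ := hc
  refine (gapIn_of_yields hg hgM hr hy ?_ ?_ (hM.withDelim _ _)).chainGap.chain_of_ne_nil hx
  · cases hu : u.getLast? with
    | none => exact leftOK_delim _
    | some c =>
      have : g.AdjOK M (.terminal c) (.nonterminal r.input) := hA _ (by simp [hu]) _ (by simp)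
      exact LeftOK.of_derives this (derives_rule hr)
  · cases hv : v.head? with
    | none => exact rightOK_delim _
    | some c =>
      have : g.AdjOK M (.nonterminal r.input) (.terminal c) := hB _ (by simp) _ (by simp [hv])
      exact RightOK.of_derives this (derives_rule hr)

/-! ### Chain bodies are constituents -/

/-- Below the symbols of the string `s`, which derives `w` between `a` and the word `z`, there is a
nonterminal whose frontier has length less than `n` and contains the occurrence of `y` in `w` that
follows the prefix `u`. This frontier is a chain body between its neighbours, and the rest of `w` is
derived from the other symbols. -/
def Inside (g : ContextFreeGrammar α) (M : OPMatrix α) (R : Set (List α))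
    (s : List (Symbol α g.NT)) (w : List α) (a : Option α) (z u y : List α) (n : ℕ) : Prop :=
  ∃ r ∈ g.rules, ∃ p u' v' q, (u' ++ y ++ v').length < n ∧
    w = p ++ (u' ++ y ++ v') ++ q ∧ u = p ++ u' ∧
    g.Derives s (p.map .terminal ++ [.nonterminal r.input] ++ q.map .terminal) ∧
    g.Yields r.output (u' ++ y ++ v') ∧
    GapIn M R (p.getLast?.or a) (u' ++ y ++ v') (q ++ z).head?

theorem exists_of_append_eq {x z u y v : List α} (h : x ++ z = u ++ y ++ v)
    (hl : z.length ≤ v.length) : ∃ v', x = u ++ y ++ v' ∧ v = v' ++ z := by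
  obtain ⟨v', rfl⟩ : z <:+ v :=
    List.suffix_of_suffix_length_le (l₃ := x ++ z) ⟨x, rfl⟩ ⟨u ++ y, h.symm⟩ hl
  exact ⟨v', by simpa [← List.append_assoc] using h, rfl⟩

theorem exists_of_append_cons_eq {x w u y v : List α} {c : α} (h : x ++ c :: w = u ++ y ++ v)
    (hl : x.length < u.length) : ∃ u', u = x ++ c :: u' ∧ w = u' ++ y ++ v := by
  obtain ⟨u', rfl⟩ : x ++ [c] <+: u :=
    List.prefix_of_prefix_length_le (l₃ := x ++ c :: w) ⟨w, by simp⟩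
      ⟨y ++ v, by simpa using h.symm⟩ (by simpa using hl)
  exact ⟨u', by simp, by simpa using h⟩

/-- If `y` lies in the first gap, the nonterminal of this gap is as required. -/
theorem inside_of_gap {s β : List (Symbol α g.NT)} {x rest z u y v : List α} {a b : Option α}
    {s' : List (Symbol α g.NT)} {n : ℕ} (hn : x.length < n) (hs : s = β ++ s')
    (hs' : g.Yields s' rest)
    (hβ : g.GapMatch β x) (hg : GapIn M R a x b) (hb : (rest ++ z).head? = b) (hy : y ≠ [])
    (he : x ++ (rest ++ z) = u ++ y ++ v) (hl : (rest ++ z).length ≤ v.length) :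
    g.Inside M R s (x ++ rest) a z u y n := by
  obtain ⟨v', rfl, rfl⟩ := exists_of_append_eq he hl
  rcases hβ with ⟨-, h⟩ | ⟨r, hr, rfl, h⟩
  · simp [hy] at h
  · exact ⟨r, hr, [], u, v', rest, hn, rfl, rfl, by simpa [hs] using hs'.derives.append_left [_], h,
      by simpa [hb] using hg⟩

/-- Containment in a constituent of the part of a right-hand side that follows the terminal `c`
implies containment in a constituent of the whole. -/
theorem Inside.append {s β : List (Symbol α g.NT)} {x w z u y : List α} {a : Option α} {c : α}
    {m n : ℕ} (hmn : m ≤ n) (hβ : g.Yields β x) (h : g.Inside M R s w (some c) z u y m) :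
    g.Inside M R (β ++ .terminal c :: s) (x ++ c :: w) a z (x ++ c :: u) y n := by
  obtain ⟨r, hr, p, u', v', q, hn, rfl, rfl, hd, hy, hg⟩ := h
  refine ⟨r, hr, x ++ c :: p, u', v', q, hn.trans_le hmn, by simp, by simp, ?_, hy, ?_⟩
  · simpa using hβ.derives.append (hd.append_left [.terminal c])
  · rwa [getLast?_append_or, or_getLast?_cons]

/-- A chain body that starts after a top-level letter `c` of a chain ends within the gap in which it
starts. -/
theorem inside_of_tailRuns (hM : M.ConflictFree) {s : List (Symbol α g.NT)} {c : α}
    {x z u y v : List α} {l : List (α × List α)} (hm : g.Match s x l) (hd : TailRuns M c x l z)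
    (hg : ∀ p ∈ gaps (some c) x l z.head?, GapIn M R p.1 p.2.1 p.2.2)
    (he : flat x l ++ z = u ++ y ++ v) (hu : u.length ≤ (flat x l).length) (hy : y ≠ [])
    (hr : Runs M (u.getLast?.or (some c)) (y ++ v) v) :
    g.Inside M R s (flat x l) (some c) z u y ((flat x l).length + 1) := by
  induction l generalizing s c x u with
  | nil =>
    have hl := hd.2.nested hM he (by simpa [flat] using hu) hy
      (.inr (hM.not_lt_of_gt hd.1)) hr
    have := inside_of_gap (s := s) (s' := []) (n := x.length + 1) (by simp) (rest := [])
      (b := z.head?) (z := z) (by simp) .nil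
      hm (hg (some c, x, z.head?) (by simp [gaps])) rfl hy he (by simpa using hl)
    simpa [flat] using this
  | cons q l ih =>
    obtain ⟨β, s', rfl, hβ, hm⟩ := hm
    simp only [gaps, List.forall_mem_cons] at hg
    rw [flat_cons_append] at he
    by_cases hlt : x.length < u.length
    · obtain ⟨u', rfl, he'⟩ := exists_of_append_cons_eq he hlt
      rw [getLast?_append_or, or_getLast?_cons] at hr
      refine (ih hm hd.2.2 hg.2 he' ?_ hr).append (by simp [flat]; omega) hβ.yields
      simp [flat] at hu
      omega
    · have hl := hd.2.1.nested hM he (by simp; omega) hy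
        (.inr (hM.not_lt_of_eq (a := some _) (b := some _) hd.1)) hr
      exact inside_of_gap (by simp [flat]) rfl (.terminal _ hm.yields) hβ hg.1 rfl hy he hl

/-- A chain body within the word derived from a right-hand side is that word, or is contained in
the frontier of one of the nonterminals of the right-hand side. -/
theorem inside_of_headRuns (hM : M.ConflictFree) {s : List (Symbol α g.NT)} {a : Option α}
    {x z u y v : List α} {l : List (α × List α)} (hm : g.Match s x l) (hd : HeadRuns M a x l z)
    (hg : ∀ p ∈ gaps a x l z.head?, GapIn M R p.1 p.2.1 p.2.2)
    (he : flat x l = u ++ y ++ v) (hy : y ≠ [])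
    (hr : Runs M (u.getLast?.or a) (y ++ (v ++ z)) (v ++ z)) :
    g.Inside M R s (flat x l) a z u y (flat x l).length ∨ (u = [] ∧ v = []) := by
  obtain - | ⟨⟨c, y₁⟩, l⟩ := l
  · exact hd.elim
  obtain ⟨β, s', rfl, hβ, hm⟩ := hm
  simp only [gaps, List.forall_mem_cons] at hg
  have he' : x ++ c :: (flat y₁ l ++ z) = u ++ y ++ (v ++ z) := by
    rw [← flat_cons_append, he, List.append_assoc]
  have hlen := congrArg List.length he
  simp only [flat, List.length_append, List.length_cons] at hlen
  by_cases hlt : x.length < u.length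
  · obtain ⟨u', rfl, he₁⟩ := exists_of_append_cons_eq he' hlt
    rw [getLast?_append_or, or_getLast?_cons] at hr
    refine .inl ((inside_of_tailRuns hM hm hd.2.2 hg.2 he₁ ?_ hy hr).append
      (by simp [flat]) hβ.yields)
    simp at hlen
    omega
  have key : (c :: (flat y₁ l ++ z)).length ≤ (v ++ z).length →
      g.Inside M R (β ++ .terminal c :: s') (flat x ((c, y₁) :: l)) a z u y
        (flat x ((c, y₁) :: l)).length :=
    inside_of_gap (by simp [flat]) rfl (.terminal _ hm.yields) hβ hg.1 rfl hy he'
  by_cases hu : u = []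
  · subst hu
    have hd₁ := hd.2.1
    rw [he'] at hd₁
    rcases hd₁.linear hM hr with h | h
    · rcases h.eq_or_push with h | ⟨d, w, z', hw, -, hp, h⟩
      · exact .inl (key (by rw [h]))
      · -- The pop of `c`, the first letter of the simple chain, takes place in front of `z`.
        obtain ⟨rfl, rfl⟩ := List.cons.inj hw
        obtain rfl := hp.unique hM hd.2.2.pops
        have := h.suffix.length_le
        exact .inr ⟨rfl, by simpa using this⟩
    · exact .inl (key h.suffix.length_le)
  · exact .inl (key (hd.2.1.nested hM he' (by simp; omega) hy (.inl hu) hr))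

/-- In every syntax tree, each occurrence of a chain body is the frontier of a subtree. -/
theorem exists_constituent (hM : M.ConflictFree) (hg : g.IsOperator) (hgM : g.opm.Contained M)
    {r : ContextFreeRule α g.NT} (hr : r ∈ g.rules) {a : Option α} {u y v z : List α}
    (hw : g.Yields r.output (u ++ y ++ v)) (hgap : GapIn M R a (u ++ y ++ v) z.head?)
    (hy : y ≠ []) (hruns : Runs M (u.getLast?.or a) (y ++ (v ++ z)) (v ++ z)) :
    ∃ A, g.Derives [.nonterminal r.input]
      (u.map .terminal ++ [.nonterminal A] ++ v.map .terminal) ∧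
      g.Derives [.nonterminal A] (y.map .terminal) := by
  induction hn : (u ++ y ++ v).length using Nat.strong_induction_on generalizing r a u v z with
  | _ n ih =>
  have hne : u ++ y ++ v ≠ [] := by simp [hy]
  obtain ⟨r', hr', hd, x, l, he, hm, hx⟩ := exists_decomposition hg hgM hr hw hne
  obtain ⟨-, x', l', he', -, hs, hgaps⟩ := hgap.exists_chain hne
  -- The syntax tree has the decomposition that the chain prescribes.
  obtain ⟨rfl, rfl⟩ := (headRuns_delim hs hgaps).unique hM hx (he'.symm.trans he)
  rcases inside_of_headRuns hM hm (headRuns_of_gapIn hs hgaps rfl) hgaps he.symm hy hruns with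
    ⟨r₁, hr₁, p, u', v', q, hlt, h₁, rfl, hd', hy', hg'⟩ | ⟨rfl, rfl⟩
  · rw [← he] at h₁
    obtain rfl : v = v' ++ q := by simpa using h₁
    rw [← he, hn] at hlt
    rw [getLast?_append_or, List.append_assoc] at hruns
    obtain ⟨A, hA, hA'⟩ := ih _ hlt hr₁ hy' hg' hruns rfl
    refine ⟨A, ((derives_rule hr).trans (hd.trans hd')).trans ?_, hA'⟩
    simpa using (hA.append_left (p.map .terminal)).append_right (q.map .terminal)
  · refine ⟨r.input, by simpa using Derives.refl _, ?_⟩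
    simpa using (derives_rule hr).trans hw.derives

theorem isConstituent_of_chain (hM : M.ConflictFree) (hg : g.IsOperator)
    (hgM : g.opm.Contained M) {u x v : List α} (hw : u ++ x ++ v ∈ g.language) (hx : x ≠ [])
    (h : M.Chain u.getLast? x v.head?) : g.IsConstituent u x v := by
  obtain ⟨r, hr, hi, hy⟩ := mem_language_iff_yields.1 hw
  have := exists_constituent hM hg hgM hr (a := none) (z := []) hy
    (gapIn_of_yields hg hgM hr hy (leftOK_delim _) (rightOK_delim _) ⟨_, rfl⟩) hx
    (by simpa using h.gapIn.runs rfl)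
  rwa [hi] at this

end ContextFreeGrammar

open OPMatrix ContextFreeGrammar

/-! ### The Boolean algebra of a matrix -/

theorem mainTheorem2 {α : Type*} [Finite α] (M : OPMatrix α) (hM : M.ConflictFree) :
    (⊥ ∈ oplFamily M ∧
      ∀ L₁ ∈ oplFamily M, ∀ L₂ ∈ oplFamily M,
        L₁ ⊔ L₂ ∈ oplFamily M ∧ L₁ ⊓ L₂ ∈ oplFamily M ∧ L₁ \ L₂ ∈ oplFamily M) ∧
    (M.EqAcyclic → ∃ T : Language α,
      IsBooleanAlgebraOfLanguages (oplFamily M) T ∧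
      (M.Complete →
        T = ⊤ ∧
        ∀ g : ContextFreeGrammar α, g.IsOPG → g.opm.Contained M → g.language = T →
          g.opm = M ∧ g.HasStructure M)) := by
  have hsup : ∀ L₁ ∈ oplFamily M, ∀ L₂ ∈ oplFamily M, L₁ ⊔ L₂ ∈ oplFamily M :=
    fun L₁ h₁ L₂ h₂ => mem_oplFamily_of_boolean hM h₁ h₂ (fun p q => p ∨ q) (fun _ _ h => h)
      fun _ => Iff.rfl
  have hinf : ∀ L₁ ∈ oplFamily M, ∀ L₂ ∈ oplFamily M, L₁ ⊓ L₂ ∈ oplFamily M :=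
    fun L₁ h₁ L₂ h₂ => mem_oplFamily_of_boolean hM h₁ h₂ (fun p q => p ∧ q)
      (fun _ _ h => .inl h.1) fun _ => Iff.rfl
  have hsdiff : ∀ L₁ ∈ oplFamily M, ∀ L₂ ∈ oplFamily M, L₁ \ L₂ ∈ oplFamily M :=
    fun L₁ h₁ L₂ h₂ => mem_oplFamily_of_boolean hM h₁ h₂ (fun p q => p ∧ ¬ q)
      (fun _ _ h => .inl h.1) fun _ => Iff.rfl
  refine ⟨⟨bot_mem_oplFamily hM, fun L₁ h₁ L₂ h₂ =>
    ⟨hsup L₁ h₁ L₂ h₂, hinf L₁ h₁ L₂ h₂, hsdiff L₁ h₁ L₂ h₂⟩⟩, fun hE => ?_⟩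
  have hT := structuredWords_mem_oplFamily hM hE
  refine ⟨structuredWords M, ⟨hT, fun L hL => le_structuredWords hL, bot_mem_oplFamily hM, hsup,
    hinf, fun L hL => hsdiff _ hT L hL⟩, fun hC => ?_⟩
  have htop := structuredWords_eq_top hC
  refine ⟨htop, fun g hg hgM hL => ?_⟩
  rw [htop] at hL
  refine ⟨opm_eq_of_language_eq_top hM hg.1 hgM hL, fun u x v hx => ?_⟩
  refine ⟨chain_of_isConstituent hC hg.1 hgM hx, isConstituent_of_chain hM hg.1 hgM ?_ hx⟩
  rw [hL]
  trivial
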